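/- Let $(W,S)$ be a finite Coxeter system, $S=\{s_1,\dots,s_n\}$, $n\ge 1$. For $i\in[n]=\{1,\dots,n\}$ let $W^i$ be the subgroup generated by $S\setminus\{s_i\}$. The Coxeter complex $\Sigma(W,S)$ is the simplicial complex whose vertices are the subsets $wW^i$ of $W$ ($w\in W$, $i\in[n]$), vertices $X_1,\dots,X_k$ forming a face if there is $w\in W$ such that every $X_j$ is of the form $wW^i$. It is a thin complex of rank $n$: every maximal face (facet) has $n$ vertices, and every face with $n-1$ vertices lies in precisely two facets. Its facets are the sets $\{wW^1,\dots,wW^n\}$, and such a facet is identified with $w$. A $k$-face is a face with $k+1$ vertices, and a flag is a sequence $X_0\subset X_1\subset\dots\subset X_{n-1}$ where $X_i$ is an $i$-face. Let $\sigma_i(F)$ be the unique flag which differs from the flag $F$ exactly in its $i$-face, and let $T=\sigma_{n-1}\cdots\sigma_1\sigma_0$. A zigzag is a sequence $\{T^i(F)\}_{i\ge 0}$, where $F$ is a flag. Its length is the smallest $l>0$ with $T^l(F)=F$, and its $k$-shadow is the sequence of the $k$-faces of its flags. It is simple if the first $l$ elements of its $0$-shadow are mutually distinct. The complex is $z$-simple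 if all its zigzags are simple. The reverse of the flag $\{x_0\}\subset\{x_0,x_1\}\subset\dots\subset\{x_0,\dots,x_{n-1}\}$ is the flag $\{x_{n-1}\}\subset\{x_{n-1},x_{n-2}\}\subset\dots\subset\{x_{n-1},\dots,x_0\}$. The reverse of a zigzag $F_1,\dots,F_l$ of length $l$ is the zigzag formed by the reverses of $F_l,\dots,F_1$. When zigzags are counted, a zigzag is identified with its cyclic permutations and with its reverse. For a permutation $\delta$ of $[n]$ let $s_\delta=s_{\delta(1)}\cdots s_{\delta(n)}$ be the corresponding Coxeter element. Its order does not depend on $\delta$; this order $h$ is the Coxeter number of $(W,S)$. Then: 1. If all irreducible components of $(W,S)$ have the same Coxeter number (in particular, if $(W,S)$ is irreducible), then $\Sigma(W,S)$ is $z$-simple. 2. The length of every zigzag in $\Sigma(W,S)$ is $nh$, and if $n\ge 2$, then there are precisely $\dfrac{|W|\,(n-1)!}{2h}$ distinct zigzags in $\Sigma(W,S)$. 3. For every zigzag in $\Sigma(W,S)$ there are $w\in W$ and a permutation $\delta$ of $[n]$ such that its $0$-shadow is $$wW^{\delta(1)},\dots,wW^{\delta(n)},\;ws_\delta W^{\delta(1)},\dots,ws_\delta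 W^{\delta(n)},\;\dots,\;ws_\delta^{h-1}W^{\delta(1)},\dots,ws_\delta^{h-1}W^{\delta(n)}$$ and its $(n-1)$-shadow is $$w,\;ws_{\delta(1)},\;ws_{\delta(1)}s_{\delta(2)},\;\dots,\;ws_\delta,\;ws_\delta s_{\delta(1)},\;\dots,\;ws_\delta^2,\;ws_\delta^2s_{\delta(1)},\;\dots,\;ws_\delta^h=w$$ (both repeated periodically). Conversely, for all $w$ and $\delta$ there is a zigzag with these shadows. -/

import Mathlib

namespace AbstractSimplicialComplex

variable {V : Type*}

/-- The facets of `K`: its maximal faces. -/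
def IsFacet (K : AbstractSimplicialComplex V) (X : Finset V) : Prop :=
  Maximal (fun Y => Y ∈ K.faces) X

/-- `K` is pure of rank `n`: all facets have cardinality `n`. -/
def IsPure (K : AbstractSimplicialComplex V) (n : ℕ) : Prop :=
  ∀ X, K.IsFacet X → X.card = n

/-- `K` is thin (of rank `n`): every `(n - 2)`-face is contained in precisely two facets.
A `k`-face is a face with `k + 1` vertices, and the empty set counts as the `(-1)`-face
(Mathlib does not list it among the faces). -/
def IsThin (K : AbstractSimplicialComplex V) (n : ℕ) : Prop :=
  ∀ R : Finset V, (R = ∅ ∨ R ∈ K.faces) → R.card + 1 = n →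
    {X : Finset V | K.IsFacet X ∧ R ⊆ X}.ncard = 2

/-- A flag `X_0 ⊂ X_1 ⊂ ⋯ ⊂ X_{n-1}` of `K`, where `X_i` is an `i`-face. -/
@[ext]
structure CompleteFlag (K : AbstractSimplicialComplex V) (n : ℕ) where
  /-- the `i`-face of the flag -/
  face : Fin n → Finset V
  face_mem : ∀ i, face i ∈ K.faces
  card_face : ∀ i, (face i).card = (i : ℕ) + 1
  face_mono : Monotone face

namespace CompleteFlag

variable {K : AbstractSimplicialComplex V} {n : ℕ}

open Classical in
/-- The flag `σ_i(F)`, obtained from `F` by replacing the `i`-face `X_i` by the other `i`-face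
incident to all `X_j`, `j ≠ i`. In a thin complex of rank `n` such a flag exists and is unique;
the second branch is never used there. -/
noncomputable def sigma (i : Fin n) (F : CompleteFlag K n) : CompleteFlag K n :=
  if h : ∃ F' : CompleteFlag K n, F'.face i ≠ F.face i ∧ ∀ j, j ≠ i → F'.face j = F.face j
  then h.choose else F

/-- The operator `T = σ_{n-1} ⋯ σ_1 σ_0` (first `σ_0`, last `σ_{n-1}`). -/
noncomputable def T (F : CompleteFlag K n) : CompleteFlag K n :=
  (List.finRange n).foldl (fun G i => sigma i G) F

open Classical in
/-- The reverse flag `R(F)`. If `F` is the flag of the vertex sequence `x_0, …, x_{n-1}`, then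
`R(F)` is the flag of `x_{n-1}, …, x_0`; its `k`-face `{x_{n-1}, …, x_{n-1-k}}` is what remains
of `X_{n-1}` when the vertices of all `X_j` with `j ≤ n - 2 - k` are removed. -/
noncomputable def reverse (F : CompleteFlag K n) : CompleteFlag K n where
  face k := (F.face ⟨n - 1, by have := k.2; omega⟩).filter
    (fun v => ∀ j : Fin n, (j : ℕ) + k + 1 < n → v ∉ F.face j)
  card_face k := by
    have hk := k.2
    have htop := F.card_face ⟨n - 1, by omega⟩
    simp only at htop
    by_cases h : (k : ℕ) + 1 < n
    · have hle : (⟨n - 2 - k, by omega⟩ : Fin n) ≤ ⟨n - 1, by omega⟩ := by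
        simp only [Fin.mk_le_mk]; omega
      have heq : (F.face ⟨n - 1, by omega⟩).filter
          (fun v => ∀ j : Fin n, (j : ℕ) + k + 1 < n → v ∉ F.face j)
          = F.face ⟨n - 1, by omega⟩ \ F.face ⟨n - 2 - k, by omega⟩ := by
        ext v
        simp only [Finset.mem_filter, Finset.mem_sdiff]
        refine and_congr_right fun _ => ⟨fun H => H _ (by simp only; omega), fun H j hj hv => H ?_⟩
        exact F.face_mono (show j ≤ ⟨n - 2 - k, by omega⟩ by
          rw [Fin.le_def]; simp only; omega) hv
      rw [heq, Finset.card_sdiff_of_subset (F.face_mono hle), htop, F.card_face]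
      simp only
      omega
    · rw [Finset.filter_true_of_mem, htop]
      · omega
      · intro v _ j hj
        omega
  face_mem k := by
    have hk := k.2
    refine (K.isRelLowerSet_faces (F.face_mem ⟨n - 1, by omega⟩)).2 (Finset.filter_subset _ _) ?_
    -- the last vertex of `F` lies in every face of the reverse flag
    by_cases h : 1 < n
    · have hlt : (F.face ⟨n - 2, by omega⟩).card < (F.face ⟨n - 1, by omega⟩).card := by
        rw [F.card_face, F.card_face]; simp only; omega
      obtain ⟨v, hv, hv'⟩ := Finset.exists_mem_notMem_of_card_lt_card hlt
      refine ⟨v, Finset.mem_filter.2 ⟨hv, fun j hj hvj => hv' ?_⟩⟩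
      exact F.face_mono (show j ≤ ⟨n - 2, by omega⟩ by
        rw [Fin.le_def]; simp only; omega) hvj
    · have hc : 0 < (F.face ⟨n - 1, by omega⟩).card := by
        rw [F.card_face]; omega
      obtain ⟨v, hv⟩ := Finset.card_pos.1 hc
      exact ⟨v, Finset.mem_filter.2 ⟨hv, fun j hj => by omega⟩⟩
  face_mono k l hkl v hv := by
    rw [Finset.mem_filter] at hv ⊢
    refine ⟨hv.1, fun j hj => hv.2 j ?_⟩
    rw [Fin.le_def] at hkl
    omega

end CompleteFlag

/-- A zigzag of `K`: a sequence `F, T(F), T²(F), …` of flags. -/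
@[ext]
structure Zigzag (K : AbstractSimplicialComplex V) (n : ℕ) where
  /-- the `i`-th flag of the zigzag -/
  flag : ℕ → CompleteFlag K n
  flag_eq : ∀ i, flag i = CompleteFlag.T^[i] (flag 0)

namespace Zigzag

variable {K : AbstractSimplicialComplex V} {n : ℕ}

/-- The length of the zigzag `F, T(F), …`: the smallest `l > 0` with `T^l(F) = F`
(and `0` if there is none). -/
noncomputable def length (Z : Zigzag K n) : ℕ :=
  Function.minimalPeriod CompleteFlag.T (Z.flag 0)

/-- The `k`-shadow of a zigzag: the sequence of the `k`-faces of its flags. -/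
def shadow (Z : Zigzag K n) (k : Fin n) (i : ℕ) : Finset V :=
  (Z.flag i).face k

/-- A zigzag of length `l` is simple if the first `l` members of its `0`-shadow are mutually
distinct. (The rank `n` is understood to be positive.) -/
def IsSimple (Z : Zigzag K n) : Prop :=
  ∀ hn : 0 < n, Set.InjOn (Z.shadow ⟨0, hn⟩) (Set.Iio Z.length)

/-- `Z'` is obtained from `Z` by a cyclic permutation of the flags: it starts at a later flag
of `Z`. -/
def IsShift (Z Z' : Zigzag K n) : Prop :=
  ∃ k, ∀ i, Z'.flag i = Z.flag (i + k)

/-- `Z'` is the reverse `R(F_{l-1}), …, R(F_1), R(F_0)` (repeated periodically) of the zigzag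
`Z = (F_0, F_1, …, F_{l-1})` of length `l`. -/
def IsReverse (Z Z' : Zigzag K n) : Prop :=
  ∀ i, Z'.flag i = (Z.flag (Z.length - 1 - i % Z.length)).reverse

end Zigzag

/-- Zigzags of `K`, where a zigzag is identified with its cyclic permutations and with its
reverse. -/
def ZigzagClass (K : AbstractSimplicialComplex V) (n : ℕ) : Type _ :=
  Quot (fun Z Z' : Zigzag K n => Z.IsShift Z' ∨ Z.IsReverse Z')

/-- A complex of rank `n` is `z`-simple if every zigzag is simple. -/
def IsZSimple (K : AbstractSimplicialComplex V) (n : ℕ) : Prop :=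
  ∀ Z : Zigzag K n, Z.IsSimple

end AbstractSimplicialComplex

namespace CoxeterSystem

variable {n : ℕ} {M : CoxeterMatrix (Fin n)} {W : Type*} [Group W] (cs : CoxeterSystem M W)

/-- The subgroup `W^i` generated by all `s_j` with `j ≠ i`. -/
def maxParabolic (i : Fin n) : Subgroup W :=
  Subgroup.closure (cs.simple '' {j | j ≠ i})

/-- The subset `w W^i` of `W`. -/
def parabolicCoset (w : W) (i : Fin n) : Set W :=
  (fun g => w * g) '' (cs.maxParabolic i : Set W)

/-- The vertices of the Coxeter complex: the subsets `w W^i` of `W`. -/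
def ComplexVertex : Type _ :=
  {X : Set W // ∃ w i, X = cs.parabolicCoset w i}

/-- The vertex `w W^i` of the Coxeter complex. -/
def vertex (w : W) (i : Fin n) : cs.ComplexVertex :=
  ⟨cs.parabolicCoset w i, w, i, rfl⟩

/-- The Coxeter complex `Σ(W, S)`: the vertices `X_1, …, X_k` form a face if there is `w` such
that each of them is of the form `w W^i`. -/
def coxeterComplex : AbstractSimplicialComplex cs.ComplexVertex where
  faces := {A | A.Nonempty ∧ ∃ w, ∀ X ∈ A, ∃ i, X = cs.vertex w i}
  isRelLowerSet_faces := fun {_} h =>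
    ⟨h.1, fun _ hB hne => ⟨hne, h.2.imp fun _ hw _ hX => hw _ (hB hX)⟩⟩
  singleton_mem := fun ⟨X, w, i, hX⟩ =>
    ⟨Finset.singleton_nonempty _, w, fun _ hY =>
      ⟨i, (Finset.mem_singleton.1 hY).trans (Subtype.ext hX)⟩⟩

open Classical in
/-- The facet `{w W^1, …, w W^n}`, which is identified with the element `w`. -/
noncomputable def chamber (w : W) : Finset cs.ComplexVertex :=
  Finset.univ.image (cs.vertex w)

/-- The product `s_{δ(1)} ⋯ s_{δ(j)}` of the first `j` factors of the Coxeter element `s_δ`. -/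
def coxeterPrefix (δ : Equiv.Perm (Fin n)) (j : ℕ) : W :=
  ((List.ofFn fun i => cs.simple (δ i)).take j).prod

/-- The Coxeter element `s_δ = s_{δ(1)} ⋯ s_{δ(n)}`. -/
def coxeterElement (δ : Equiv.Perm (Fin n)) : W :=
  (List.ofFn fun i => cs.simple (δ i)).prod

/-- The Coxeter number: the order of the Coxeter element `s_1 ⋯ s_n`. -/
noncomputable def coxeterNumber : ℕ :=
  orderOf (cs.coxeterElement 1)

/-- The graph underlying the diagram of a Coxeter system: `i` and `j` are joined by an edge if
`s_i` and `s_j` do not commute. -/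
def diagram (_cs : CoxeterSystem M W) : SimpleGraph (Fin n) where
  Adj i j := i ≠ j ∧ M i j ≠ 2
  symm := ⟨fun i j h => ⟨h.1.symm, by rw [M.symmetric j i]; exact h.2⟩⟩
  loopless := ⟨fun _ h => h.1 rfl⟩

open Classical in
/-- The Coxeter number of the irreducible component of `(W, S)` that contains `s_i`: the order of
the product of all `s_j` with `j` in the connected component of `i` in the diagram. -/
noncomputable def componentCoxeterNumber (i : Fin n) : ℕ :=
  orderOf (((List.finRange n).filter (fun j => cs.diagram.Reachable i j)).map cs.simple).prod

/-- In an irreducible system the only component is the whole system. -/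
theorem componentCoxeterNumber_eq_of_connected (h : cs.diagram.Connected) (i : Fin n) :
    cs.componentCoxeterNumber i = cs.coxeterNumber := by
  have hr : ∀ j, cs.diagram.Reachable i j := fun j => h.preconnected i j
  simp [componentCoxeterNumber, coxeterNumber, coxeterElement, hr, List.ofFn_eq_map]

end CoxeterSystem

/-! A flag of the Coxeter complex amounts to a pair (w, δ) of a chamber and an ordering of its
vertices (`exists_eq_mkFlag`, `mkFlag_injective`). On pairs, `sigma i` exchanges two neighboring
entries of δ unless i is the last position, where it multiplies w by the reflection of the last
entry. Hence T(w, δ) = (w s_{δ(1)}, δ ∘ rotation) (`T_mkFlag`) and T^n(w, δ) = (w s_δ, δ). The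
shadows and the length nh can be read off. The reversal R satisfies T R T = R, so T and R generate a
dihedral group of order 2nh; for n ≥ 2 it acts freely on the |W| n! flags, and the zigzag classes
are its orbits.

Parabolic subgroups are controlled by the geometric representation in coordinates with respect to
the simple roots. Since s_i changes only coordinate i, the subgroup W_I preserves all coordinates
outside I; the converse (`mem_closure_of_geomRep_apply`) holds because w sends α_i to a nonpositive
vector if i is a right descent of w. This yields thinness and the uniqueness of (w, δ). For finite W
the canonical form is positive definite (`bilin_self_pos`), so the diagram is a forest and all
Coxeter elements are conjugate (`rotationEquiv_of_perm`).

A repetition in the 0-shadow means that a power c^d of a Coxeter element, 0 ≤ d < h, lies in some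
W^i, that is, preserves coordinate i. By `geomRep_pow_apply_of_adj` it then preserves the
coordinates of the whole component of i, and so the Coxeter number of that component divides d
(`componentCoxeterNumber_dvd`). If this number is h, then d = 0. -/

open scoped Real

/-! ### The canonical bilinear form and its reflections -/

namespace CoxeterMatrix

variable {B : Type*} (M : CoxeterMatrix B)

/-- The matrix of the canonical bilinear form of a Coxeter matrix. -/
noncomputable def cosine (i j : B) : ℝ := -Real.cos (π / M i j)

theorem cosine_symm (i j : B) : M.cosine i j = M.cosine j i := by
  rw [cosine, cosine, M.symmetric]

@[simp]
theorem cosine_self (i : B) : M.cosine i i = 1 := by simp [cosine]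

theorem cosine_nonpos {i j : B} (h : i ≠ j) : M.cosine i j ≤ 0 := by
  rw [cosine, neg_nonpos]
  have h1 := M.off_diagonal i j h
  -- The entry 0 stands for infinite order; division by zero then makes the angle 0 and the cosine
  -- entry -1.
  rcases Nat.eq_zero_or_pos (M i j) with h0 | h0
  · simp [h0]
  · have h2 : (2 : ℝ) ≤ M i j := by exact_mod_cast (show 2 ≤ M i j by omega)
    apply Real.cos_nonneg_of_neg_pi_div_two_le_of_le
    · have : 0 ≤ π / M i j := by positivity
      linarith [Real.pi_pos]
    · exact div_le_div_of_nonneg_left Real.pi_pos.le (by norm_num) h2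

theorem cosine_le_neg_half {i j : B} (h : i ≠ j) (h2 : M i j ≠ 2) :
    M.cosine i j ≤ -(1 / 2) := by
  rw [cosine, neg_le_neg_iff]
  have h1 := M.off_diagonal i j h
  rcases Nat.eq_zero_or_pos (M i j) with h0 | h0
  · simp [h0]; norm_num
  · have h3 : (3 : ℝ) ≤ M i j := by exact_mod_cast (show 3 ≤ M i j by omega)
    rw [← Real.cos_pi_div_three]
    apply Real.cos_le_cos_of_nonneg_of_le_pi
    · positivity
    · linarith [Real.pi_pos]
    · exact div_le_div_of_nonneg_left Real.pi_pos.le (by norm_num) h3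

theorem cosine_eq_zero {i j : B} (h2 : M i j = 2) : M.cosine i j = 0 := by
  simp [cosine, h2]

section Plane

variable [DecidableEq B]

/-- A vector in the plane of two simple roots. -/
noncomputable def planeVec (i j : B) (a b : ℝ) : B → ℝ := Pi.single i a + Pi.single j b

theorem planeVec_comm (i j : B) (a b : ℝ) : planeVec i j a b = planeVec j i b a := add_comm _ _

end Plane

variable [Fintype B]

/-- The linear form `v ↦ ⟨α_i, v⟩` of the canonical bilinear form. -/
noncomputable def form (i : B) : (B → ℝ) →ₗ[ℝ] ℝ := ∑ j, M.cosine i j • LinearMap.proj j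

theorem form_apply (i : B) (v : B → ℝ) : M.form i v = ∑ j, M.cosine i j * v j := by
  simp [form]

/-- The canonical bilinear form. -/
noncomputable def bilin (v w : B → ℝ) : ℝ := ∑ i, v i * M.form i w

theorem bilin_comm (v w : B → ℝ) : M.bilin v w = M.bilin w v := by
  simp only [bilin, form_apply, Finset.mul_sum]
  rw [Finset.sum_comm]
  refine Finset.sum_congr rfl fun i _ => Finset.sum_congr rfl fun j _ => ?_
  rw [M.cosine_symm]; ring

variable [DecidableEq B]

@[simp]
theorem form_single (i j : B) (a : ℝ) : M.form i (Pi.single j a) = M.cosine i j * a := by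
  simp [form_apply, Pi.single_apply]

/-- The simple reflections of the geometric representation, in the basis of simple roots. -/
noncomputable def geomReflection (i : B) : Module.End ℝ (B → ℝ) :=
  LinearMap.id - (2 : ℝ) • (M.form i).smulRight (Pi.single i 1)

theorem geomReflection_apply (i : B) (v : B → ℝ) :
    M.geomReflection i v = v - (2 * M.form i v) • Pi.single i (1 : ℝ) := by
  simp [geomReflection, mul_smul]

theorem geomReflection_apply_of_ne {i j : B} (h : j ≠ i) (v : B → ℝ) :
    M.geomReflection i v j = v j := by
  simp [geomReflection_apply, h]

theorem geomReflection_apply_self (i : B) (v : B → ℝ) :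
    M.geomReflection i v i = v i - 2 * M.form i v := by
  simp [geomReflection_apply]

theorem geomReflection_of_form_eq_zero {i : B} {v : B → ℝ} (h : M.form i v = 0) :
    M.geomReflection i v = v := by
  simp [geomReflection_apply, h]

theorem form_geomReflection (i : B) (v : B → ℝ) :
    M.form i (M.geomReflection i v) = -M.form i v := by
  simp [geomReflection_apply]; ring

theorem geomReflection_mul_self (i : B) : M.geomReflection i * M.geomReflection i = 1 := by
  refine LinearMap.ext fun v => ?_
  change M.geomReflection i (M.geomReflection i v) = v
  rw [geomReflection_apply, form_geomReflection, geomReflection_apply]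
  module

theorem geomReflection_planeVec {i j : B} (a b : ℝ) :
    M.geomReflection j (planeVec i j a b)
      = planeVec i j a (2 * Real.cos (π / M i j) * a - b) := by
  have h : M.form j (planeVec i j a b) = -Real.cos (π / M i j) * a + b := by
    simp only [planeVec, map_add, form_single, cosine_self, one_mul]
    rw [cosine_symm, cosine]
  rw [geomReflection_apply, h, planeVec, planeVec]
  ext l
  simp only [Pi.sub_apply, Pi.add_apply, Pi.smul_apply, Pi.single_apply, smul_eq_mul]
  split_ifs <;> ring

/-- With θ = π / M i j this is sin x + sin (x + 2θ) = 2 cos θ sin (x + θ). It makes s_i s_j a shift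
of the phase x by 2θ. -/
theorem geomReflection_planeVec_sin (i j : B) (x : ℝ) :
    M.geomReflection j (planeVec i j (Real.sin (x + π / M i j)) (Real.sin x))
      = planeVec i j (Real.sin (x + π / M i j)) (Real.sin (x + 2 * (π / M i j))) := by
  rw [geomReflection_planeVec]
  congr 1
  rw [show x + 2 * (π / M i j) = (x + π / M i j) + π / M i j by ring]
  conv_lhs => rw [show Real.sin x = Real.sin ((x + π / M i j) - π / M i j) by congr 1; ring]
  rw [Real.sin_add (x + π / M i j), Real.sin_sub (x + π / M i j)]
  ring

theorem geomReflection_mul_pow_planeVec (i j : B) (x : ℝ) (k : ℕ) :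
    ((M.geomReflection i * M.geomReflection j) ^ k)
        (planeVec i j (Real.sin (x + π / M i j)) (Real.sin x))
      = planeVec i j (Real.sin (x + 2 * k * (π / M i j) + π / M i j))
        (Real.sin (x + 2 * k * (π / M i j))) := by
  induction k with
  | zero => simp
  | succ k ih =>
    rw [pow_succ', Module.End.mul_apply, ih, Module.End.mul_apply, geomReflection_planeVec_sin,
      planeVec_comm, M.symmetric i j]
    have := M.geomReflection_planeVec_sin j i (x + 2 * k * (π / M j i) + π / M j i)
    rw [show x + 2 * k * (π / M j i) + 2 * (π / M j i)
      = x + 2 * k * (π / M j i) + π / M j i + π / M j i by ring, this, planeVec_comm]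
    push_cast
    congr 2 <;> ring

theorem geomReflection_isLiftable : M.IsLiftable M.geomReflection := by
  intro i j
  by_cases hij : i = j
  · subst hij; simp [geomReflection_mul_self]
  rcases Nat.eq_zero_or_pos (M i j) with h0 | h0
  · simp [h0]
  have h1 := M.off_diagonal i j hij
  have hm2 : (2 : ℝ) ≤ M i j := by exact_mod_cast (show 2 ≤ M i j by omega)
  have hs : Real.sin (π / M i j) ≠ 0 := by
    apply ne_of_gt
    apply Real.sin_pos_of_pos_of_lt_pi (by positivity)
    exact div_lt_self Real.pi_pos (by linarith)
  set P := M.geomReflection i * M.geomReflection j with hP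
  have key : ∀ x, (P ^ M i j) (planeVec i j (Real.sin (x + π / M i j)) (Real.sin x))
      = planeVec i j (Real.sin (x + π / M i j)) (Real.sin x) := by
    intro x
    rw [geomReflection_mul_pow_planeVec]
    have e : x + 2 * (M i j : ℝ) * (π / M i j) = x + 2 * π := by field_simp
    rw [e, Real.sin_add_two_pi, show x + 2 * π + π / M i j = x + π / M i j + 2 * π by ring,
      Real.sin_add_two_pi]
  -- The phase x = 0 gives a nonzero multiple of α_i, the phase x = -π / M i j one of α_j.
  have hi : (P ^ M i j) (Pi.single i 1) = Pi.single i 1 := by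
    have := key 0
    simp only [zero_add, Real.sin_zero, planeVec, Pi.single_zero, add_zero] at this
    have e : (Pi.single i (Real.sin (π / M i j)) : B → ℝ)
        = Real.sin (π / M i j) • Pi.single i 1 := by simp [← Pi.single_smul]
    rw [e, map_smul] at this
    exact smul_right_injective _ hs this
  have hj : (P ^ M i j) (Pi.single j 1) = Pi.single j 1 := by
    have := key (-(π / M i j))
    simp only [neg_add_cancel, Real.sin_zero, planeVec, Pi.single_zero, zero_add,
      Real.sin_neg] at this
    have e : (Pi.single j (-Real.sin (π / M i j)) : B → ℝ)
        = (-Real.sin (π / M i j)) • Pi.single j 1 := by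
      rw [← Pi.single_smul, smul_eq_mul, mul_one]
    rw [e, map_smul] at this
    exact smul_right_injective _ (neg_ne_zero.2 hs) this
  refine LinearMap.ext fun v => ?_
  set c := M.cosine i j with hc
  -- The Gram determinant of α_i, α_j is nonzero, so v splits into a vector of their plane and a
  -- vector p orthogonal to it, which both reflections fix.
  have hc2 : 1 - c ^ 2 ≠ 0 := by
    rw [hc, cosine, neg_sq, ← Real.sin_sq]
    exact pow_ne_zero 2 hs
  set a := (M.form i v - c * M.form j v) / (1 - c ^ 2)
  set b := (M.form j v - c * M.form i v) / (1 - c ^ 2)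
  set p := v - a • Pi.single i (1 : ℝ) - b • Pi.single j (1 : ℝ) with hp
  have hpi : M.form i p = 0 := by
    simp only [hp, map_sub, map_smul, form_single, cosine_self, smul_eq_mul, mul_one, ← hc, a, b]
    field_simp; ring
  have hpj : M.form j p = 0 := by
    simp only [hp, map_sub, map_smul, form_single, cosine_self, smul_eq_mul, mul_one,
      M.cosine_symm j i, ← hc, a, b]
    field_simp; ring
  have hPp : ∀ k : ℕ, (P ^ k) p = p := by
    intro k
    induction k with
    | zero => simp
    | succ k ih =>
      rw [pow_succ', Module.End.mul_apply, ih, hP, Module.End.mul_apply,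
        M.geomReflection_of_form_eq_zero hpj, M.geomReflection_of_form_eq_zero hpi]
  have hv : v = p + a • Pi.single i (1 : ℝ) + b • Pi.single j (1 : ℝ) := by rw [hp]; abel
  rw [hv]
  simp only [map_add, map_smul, hi, hj, hPp, Module.End.one_apply]

theorem bilin_single (i : B) (v : B → ℝ) : M.bilin (Pi.single i 1) v = M.form i v := by
  simp [bilin, Pi.single_apply]

end CoxeterMatrix

/-! ### The geometric representation of a finite Coxeter group -/

namespace CoxeterSystem

variable {B : Type*} [Fintype B] [DecidableEq B] {M : CoxeterMatrix B} {W : Type*} [Group W]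
  (cs : CoxeterSystem M W)

/-- The geometric representation. -/
noncomputable def geomRep : W →* Module.End ℝ (B → ℝ) :=
  cs.lift ⟨M.geomReflection, M.geomReflection_isLiftable⟩

@[simp]
theorem geomRep_simple (i : B) : cs.geomRep (cs.simple i) = M.geomReflection i :=
  cs.lift_apply_simple _ i

theorem geomRep_mul_apply (w w' : W) (v : B → ℝ) :
    cs.geomRep (w * w') v = cs.geomRep w (cs.geomRep w' v) := by
  rw [map_mul, Module.End.mul_apply]

theorem geomRep_self_apply_inv (w : W) (v : B → ℝ) : cs.geomRep w (cs.geomRep w⁻¹ v) = v := by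
  rw [← geomRep_mul_apply]; simp

theorem bilin_geomReflection (i : B) (v w : B → ℝ) :
    M.bilin (M.geomReflection i v) w = M.bilin v (M.geomReflection i w) := by
  have h1 : ∀ v w, M.bilin (M.geomReflection i v) w
      = M.bilin v w - 2 * M.form i v * M.form i w := by
    intro v w
    simp only [CoxeterMatrix.bilin, M.geomReflection_apply, Pi.sub_apply, Pi.smul_apply,
      smul_eq_mul, sub_mul, Finset.sum_sub_distrib]
    simp [Pi.single_apply]
  rw [h1, M.bilin_comm v (M.geomReflection i w), h1, M.bilin_comm w]
  ring

theorem bilin_geomRep (w : W) (u v : B → ℝ) :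
    M.bilin (cs.geomRep w u) (cs.geomRep w v) = M.bilin u v := by
  induction w using cs.simple_induction_left with
  | one => simp
  | mul_simple_left w i ih =>
    rw [geomRep_mul_apply, geomRep_mul_apply, geomRep_simple, bilin_geomReflection,
      ← Module.End.mul_apply, M.geomReflection_mul_self, Module.End.one_apply, ih]

section Finite

variable [Fintype W]

/-- An inner product that is invariant under the geometric representation. -/
noncomputable def averagedForm : LinearMap.BilinForm ℝ (B → ℝ) :=
  ∑ w : W, LinearMap.compl₁₂ (dotProductBilin ℝ ℝ) (cs.geomRep w) (cs.geomRep w)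

theorem averagedForm_apply (u v : B → ℝ) :
    cs.averagedForm u v = ∑ w : W, cs.geomRep w u ⬝ᵥ cs.geomRep w v := by
  simp [averagedForm, LinearMap.sum_apply]

theorem averagedForm_comm (u v : B → ℝ) : cs.averagedForm u v = cs.averagedForm v u := by
  simp [averagedForm_apply, dotProduct_comm]

theorem averagedForm_geomRep (w : W) (u v : B → ℝ) :
    cs.averagedForm (cs.geomRep w u) (cs.geomRep w v) = cs.averagedForm u v := by
  simp only [averagedForm_apply, ← geomRep_mul_apply]
  exact Fintype.sum_equiv (Equiv.mulRight w) _ _ fun _ => rfl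

theorem averagedForm_self_pos {v : B → ℝ} (hv : v ≠ 0) : 0 < cs.averagedForm v v := by
  rw [averagedForm_apply]
  have h : ∀ u : B → ℝ, 0 ≤ u ⬝ᵥ u := fun u => Finset.sum_nonneg fun i _ => mul_self_nonneg _
  refine Finset.sum_pos' (fun w _ => h _) ⟨1, Finset.mem_univ _, ?_⟩
  rw [map_one, Module.End.one_apply]
  refine lt_of_le_of_ne (h _) (Ne.symm ?_)
  rwa [Ne, dotProduct_self_eq_zero]

/-- By invariance under s_i, this map is the orthogonal reflection in α_i for the averaged inner
product too. -/
theorem form_mul_averagedForm (i : B) (v : B → ℝ) :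
    M.form i v * cs.averagedForm (Pi.single i 1) (Pi.single i 1)
      = cs.averagedForm v (Pi.single i 1) := by
  have h := cs.averagedForm_geomRep (cs.simple i) v (Pi.single i 1)
  rw [geomRep_simple, M.geomReflection_apply, M.geomReflection_apply] at h
  simp only [map_sub, map_smul, LinearMap.sub_apply, LinearMap.smul_apply, smul_eq_mul,
    CoxeterMatrix.form_single, CoxeterMatrix.cosine_self] at h
  linarith

end Finite

-- The averaged inner product of α_i and α_j is `cosine i j` times c_i; by symmetry c_i = c_j
-- whenever `cosine i j` is nonzero. Dividing each coordinate by √(c_i) therefore turns the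
-- canonical form into the averaged one.
include cs in
theorem bilin_self_pos [Finite W] {v : B → ℝ} (hv : v ≠ 0) : 0 < M.bilin v v := by
  have := Fintype.ofFinite W
  set c : B → ℝ := fun i => cs.averagedForm (Pi.single i 1) (Pi.single i 1)
  have hc : ∀ i, 0 < c i := fun i => cs.averagedForm_self_pos (by simp)
  have hsymm : ∀ i j, M.cosine i j * c i = M.cosine i j * c j := by
    intro i j
    have h1 := cs.form_mul_averagedForm i (Pi.single j 1)
    have h2 := cs.form_mul_averagedForm j (Pi.single i 1)
    rw [M.form_single, mul_one] at h1 h2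
    change M.cosine i j * c i = _ at h1
    change M.cosine j i * c j = _ at h2
    rw [h1, M.cosine_symm, h2, averagedForm_comm]
  set u : B → ℝ := fun i => v i / √(c i) with hu
  have hu0 : u ≠ 0 := by
    intro h
    apply hv
    ext i
    have := congrFun h i
    simpa [hu, (Real.sqrt_pos.2 (hc i)).ne'] using this
  convert cs.averagedForm_self_pos hu0 using 1
  have hexp : cs.averagedForm u u = ∑ i, u i * (M.form i u * c i) := by
    simp only [c, form_mul_averagedForm]
    conv_lhs => rw [LinearMap.pi_apply_eq_sum_univ (cs.averagedForm u) u]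
    refine Finset.sum_congr rfl fun i _ => ?_
    rw [smul_eq_mul]
    congr 2
    ext j
    simp [Pi.single_apply, eq_comm]
  rw [hexp, CoxeterMatrix.bilin]
  refine Finset.sum_congr rfl fun i _ => ?_
  rw [M.form_apply, M.form_apply, Finset.sum_mul, Finset.mul_sum, Finset.mul_sum]
  refine Finset.sum_congr rfl fun j _ => ?_
  have hi := Real.sqrt_pos.2 (hc i)
  have hj := Real.sqrt_pos.2 (hc j)
  rcases eq_or_ne (M.cosine i j) 0 with h0 | h0
  · simp [h0]
  · have hij : c i = c j := mul_left_cancel₀ h0 (hsymm i j)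
    have hs : √(c j) * √(c j) = c j := Real.mul_self_sqrt (hc j).le
    simp only [hu, hij] at *
    field_simp
    rw [pow_two, hs]

-- If s_i s_j had the entry 0, then α_i + α_j would be isotropic.
include cs in
theorem matrix_ne_zero [Finite W] (i j : B) : M i j ≠ 0 := by
  intro h
  have hij : i ≠ j := by rintro rfl; simp at h
  have hc : M.cosine i j = -1 := by simp [CoxeterMatrix.cosine, h]
  have hv : (Pi.single i 1 + Pi.single j 1 : B → ℝ) ≠ 0 := fun h0 => by
    simpa [hij] using congrFun h0 i
  have := cs.bilin_self_pos hv
  have e : M.bilin (Pi.single i 1 + Pi.single j 1) (Pi.single i 1 + Pi.single j 1) = 0 := by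
    have : ∀ w, M.bilin (Pi.single i 1 + Pi.single j 1) w = M.form i w + M.form j w := by
      intro w
      rw [← M.bilin_single i, ← M.bilin_single j]
      simp [CoxeterMatrix.bilin, add_mul, Finset.sum_add_distrib]
    rw [this]
    simp [M.cosine_symm j i, hc]
  linarith

/-- The alternating word ends in j, so s_j acts first, and each letter advances the two phases by
one step π / M i j. Both coordinates are nonnegative as long as k + 1 ≤ M i j. -/
theorem geomRep_alternatingWord {i j : B} (k : ℕ) :
    cs.geomRep (cs.wordProd (alternatingWord i j k))
        (Pi.single i (Real.sin (π / M i j))) =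
      if Even k then CoxeterMatrix.planeVec i j (Real.sin ((k + 1) * (π / M i j)))
        (Real.sin (k * (π / M i j)))
      else CoxeterMatrix.planeVec i j (Real.sin (k * (π / M i j)))
        (Real.sin ((k + 1) * (π / M i j))) := by
  induction k with
  | zero => simp [alternatingWord, CoxeterMatrix.planeVec]
  | succ k ih =>
    rw [alternatingWord_succ', wordProd_cons, geomRep_mul_apply, ih]
    by_cases hk : Even k
    · have hk' : ¬ Even (k + 1) := by simpa [Nat.even_add_one] using hk
      simp only [hk, hk', if_true, if_false, geomRep_simple]
      have := M.geomReflection_planeVec_sin i j (k * (π / M i j))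
      rw [show ((k : ℝ) + 1) * (π / M i j) = k * (π / M i j) + π / M i j by ring, this]
      push_cast
      congr 2 <;> ring
    · have hk' : Even (k + 1) := by simpa [Nat.even_add_one] using hk
      simp only [hk, hk', if_true, if_false, geomRep_simple]
      have := M.geomReflection_planeVec_sin j i (k * (π / M j i))
      rw [CoxeterMatrix.planeVec_comm, M.symmetric i j,
        show ((k : ℝ) + 1) * (π / M j i) = k * (π / M j i) + π / M j i by ring, this,
        CoxeterMatrix.planeVec_comm]
      push_cast
      congr 2 <;> ring

/-- If `ℓ (w s_i) > ℓ w`, then `w` maps the simple root `α_i` to a positive root. -/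
theorem geomRep_single_nonneg [Finite W] (w : W) (i : B) (h : ¬ cs.IsRightDescent w i) :
    0 ≤ cs.geomRep w (Pi.single i 1) := by
  induction hl : cs.length w using Nat.strong_induction_on generalizing w i with
  | _ l ih =>
  by_cases hw : w = 1
  · subst hw; simp [Pi.single_nonneg]
  obtain ⟨j, hj⟩ := cs.exists_rightDescent_of_ne_one hw
  have hij : i ≠ j := by rintro rfl; exact h hj
  -- Split off on the right the longest alternating word in i and j that ends in j and has additive
  -- length. The remaining v has neither i nor j as a right descent, so induction makes v α_i and v
  -- α_j nonnegative.
  let P : ℕ → Prop := fun k => ∃ v, w = v * cs.wordProd (alternatingWord i j k) ∧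
    cs.length v + k = cs.length w
  have hP1 : P 1 := by
    refine ⟨w * cs.simple j, by simp [alternatingWord], ?_⟩
    exact cs.isRightDescent_iff.1 hj
  have hPle : ∀ k, P k → k ≤ cs.length w := by rintro k ⟨v, -, hv⟩; omega
  obtain ⟨k, hk, hkmax⟩ : ∃ k, P k ∧ ∀ k', P k' → k' ≤ k := by
    classical
    refine ⟨Nat.findGreatest P (cs.length w), Nat.findGreatest_spec (hPle 1 hP1) hP1, ?_⟩
    exact fun k' h' => Nat.le_findGreatest (hPle k' h') h'
  have hk1 := hkmax 1 hP1
  obtain ⟨v, hwv, hlv⟩ := hk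
  have halt : ∀ (i j : B) m, cs.length (cs.wordProd (alternatingWord i j m)) ≤ m := fun i j m => by
    simpa using cs.length_wordProd_le (alternatingWord i j m)
  have hdesc : ∀ x, (x = i ∨ x = j) → ¬ cs.IsRightDescent v x := by
    intro x hx hd
    rw [cs.isRightDescent_iff] at hd
    -- Either x would prolong the alternating word, against maximality, or it is its first letter
    -- and would cancel, which makes w too short.
    by_cases hxk : x = if Even k then j else i
    · have hx' : P (k + 1) := by
        refine ⟨v * cs.simple x, ?_, by omega⟩
        rw [alternatingWord_succ', wordProd_cons, ← hxk, hwv]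
        simp [mul_assoc]
      have := hkmax _ hx'
      omega
    · obtain ⟨k', rfl⟩ : ∃ k', k = k' + 1 := ⟨k - 1, by omega⟩
      have hx' : x = if Even k' then j else i := by
        by_cases hk' : Even k' <;> simp [hk', Nat.even_add_one] at hxk ⊢ <;> tauto
      have e : w = (v * cs.simple x) * cs.wordProd (alternatingWord i j k') := by
        rw [hwv, alternatingWord_succ', wordProd_cons, ← hx', mul_assoc]
      have h1 := cs.length_mul_le (v * cs.simple x) (cs.wordProd (alternatingWord i j k'))
      rw [← e] at h1
      have := halt i j k'
      omega
  have hm0 := cs.matrix_ne_zero i j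
  -- Otherwise a braid relation would let w end in s_i, against the assumption that i is not a
  -- descent.
  have hkm : k < M i j := by
    by_contra! hcon
    apply h
    have hsplit : ∀ a b, ∃ u, cs.wordProd (alternatingWord i j (a + b))
        = u * cs.wordProd (alternatingWord i j b) ∧ cs.length u ≤ a := by
      intro a b
      induction a with
      | zero => exact ⟨1, by simp, by simp⟩
      | succ a iha =>
        obtain ⟨u, hu, hul⟩ := iha
        refine ⟨cs.simple (if Even (a + b) then j else i) * u, ?_, ?_⟩
        · rw [show a + 1 + b = a + b + 1 by ring, alternatingWord_succ', wordProd_cons, hu,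
            mul_assoc]
        · have := cs.length_mul_le (cs.simple (if Even (a + b) then j else i)) u
          rw [length_simple] at this
          omega
    obtain ⟨u, hu, hul⟩ := hsplit (k - M i j) (M i j)
    rw [Nat.sub_add_cancel hcon] at hu
    have hbr := cs.wordProd_braidWord_eq i j
    rw [CoxeterSystem.braidWord, CoxeterSystem.braidWord, M.symmetric j i] at hbr
    obtain ⟨m, hm⟩ : ∃ m, M i j = m + 1 := ⟨M i j - 1, by omega⟩
    have e : w * cs.simple i = v * u * cs.wordProd (alternatingWord i j m) := by
      rw [hwv, hu, hbr, hm, alternatingWord_succ, wordProd_concat]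
      simp [mul_assoc]
    have h1 := cs.length_mul_le (v * u) (cs.wordProd (alternatingWord i j m))
    have h2 := cs.length_mul_le v u
    have h3 := halt i j m
    rw [← e] at h1
    rw [CoxeterSystem.IsRightDescent]
    omega
  have hi := ih (cs.length v) (by omega) v i (hdesc i (Or.inl rfl)) rfl
  have hj' := ih (cs.length v) (by omega) v j (hdesc j (Or.inr rfl)) rfl
  have h1 := M.off_diagonal i j hij
  have hmpos : (0 : ℝ) < M i j := by exact_mod_cast Nat.pos_of_ne_zero hm0
  have hm2 : (2 : ℝ) ≤ M i j := by exact_mod_cast (show 2 ≤ M i j by omega)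
  have hs : 0 < Real.sin (π / M i j) := by
    apply Real.sin_pos_of_pos_of_lt_pi (div_pos Real.pi_pos hmpos)
    exact div_lt_self Real.pi_pos (by linarith)
  have hsin : ∀ a : ℝ, 0 ≤ a → a ≤ M i j → 0 ≤ Real.sin (a * (π / M i j)) := by
    intro a ha ham
    apply Real.sin_nonneg_of_nonneg_of_le_pi
    · have := Real.pi_pos; positivity
    · calc a * (π / M i j) ≤ M i j * (π / M i j) := by
            gcongr
        _ = π := by field_simp
  have hk' : (k : ℝ) + 1 ≤ M i j := by exact_mod_cast hkm
  have hk0 : (0 : ℝ) ≤ k := by positivity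
  have hplane : ∀ a b : ℝ, 0 ≤ a → 0 ≤ b →
      0 ≤ cs.geomRep v (CoxeterMatrix.planeVec i j a b) := by
    intro a b ha hb
    have e : CoxeterMatrix.planeVec i j a b
        = a • Pi.single i (1 : ℝ) + b • Pi.single j (1 : ℝ) := by
      rw [CoxeterMatrix.planeVec, ← Pi.single_smul, ← Pi.single_smul]; simp
    rw [e, map_add, map_smul, map_smul]
    exact add_nonneg (smul_nonneg ha hi) (smul_nonneg hb hj')
  have hfin : 0 ≤ cs.geomRep w (Pi.single i (Real.sin (π / M i j))) := by
    rw [hwv, geomRep_mul_apply, geomRep_alternatingWord]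
    split_ifs
    · exact hplane _ _ (hsin _ (by linarith) hk') (hsin _ hk0 (by linarith))
    · exact hplane _ _ (hsin _ hk0 (by linarith)) (hsin _ (by linarith) hk')
  rw [show (Pi.single i (Real.sin (π / M i j)) : B → ℝ)
    = Real.sin (π / M i j) • Pi.single i 1 by simp [← Pi.single_smul], map_smul] at hfin
  intro l
  have := hfin l
  simp only [Pi.zero_apply, Pi.smul_apply, smul_eq_mul] at this
  exact nonneg_of_mul_nonneg_right this hs

theorem geomRep_single_nonpos [Finite W] {w : W} {i : B} (h : cs.IsRightDescent w i) :
    cs.geomRep w (Pi.single i 1) ≤ 0 := by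
  have h1 := cs.geomRep_single_nonneg (w * cs.simple i) i
    ((cs.isRightDescent_iff_not_isRightDescent_mul).1 h)
  have e : M.geomReflection i (Pi.single i 1) = -Pi.single i (1 : ℝ) := by
    rw [M.geomReflection_apply, M.form_single, M.cosine_self]; module
  rw [geomRep_mul_apply, geomRep_simple, e, map_neg] at h1
  exact neg_nonneg.1 h1

theorem geomRep_apply_of_mem_closure {I : Set B} {w : W}
    (hw : w ∈ Subgroup.closure (cs.simple '' I)) {j : B} (hj : j ∉ I) (v : B → ℝ) :
    cs.geomRep w v j = v j := by
  induction hw using Subgroup.closure_induction generalizing v with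
  | mem x hx =>
    obtain ⟨i, hi, rfl⟩ := hx
    rw [geomRep_simple, M.geomReflection_apply_of_ne (by rintro rfl; exact hj hi)]
  | one => simp
  | mul x y _ _ hx hy => rw [geomRep_mul_apply, hx, hy]
  | inv x _ hx => rw [← hx (cs.geomRep x⁻¹ v), geomRep_self_apply_inv]

/-- A right descent i of w lies in I, as otherwise coordinate i of w α_i would be 1 and not
nonpositive. So w can be shortened by a generator from I. -/
theorem mem_closure_of_geomRep_apply [Finite W] {I : Set B} (w : W)
    (h : ∀ j ∉ I, ∀ v, cs.geomRep w v j = v j) : w ∈ Subgroup.closure (cs.simple '' I) := by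
  induction hl : cs.length w using Nat.strong_induction_on generalizing w with
  | _ l ih =>
  by_cases hw : w = 1
  · subst hw; exact one_mem _
  obtain ⟨i, hi⟩ := cs.exists_rightDescent_of_ne_one hw
  have hiI : i ∈ I := by
    by_contra hcon
    have h1 := cs.geomRep_single_nonpos hi i
    rw [h i hcon] at h1
    norm_num at h1
  have hmem : cs.simple i ∈ Subgroup.closure (cs.simple '' I) :=
    Subgroup.subset_closure ⟨i, hiI, rfl⟩
  have h2 := ih (cs.length (w * cs.simple i)) (by rw [← hl]; exact hi) (w * cs.simple i)
    (fun j hj v => by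
      rw [geomRep_mul_apply, h j hj, geomRep_simple,
        M.geomReflection_apply_of_ne (by rintro rfl; exact hj hiI)]) rfl
  have := mul_mem h2 hmem
  simpa [mul_assoc] using this

theorem eq_one_of_geomRep [Finite W] {w : W} (h : ∀ v, cs.geomRep w v = v) : w = 1 := by
  have := cs.mem_closure_of_geomRep_apply (I := ∅) w fun j _ v => by rw [h]
  simpa using this

end CoxeterSystem

/-! ### The diagram is a forest, and all Coxeter elements are conjugate -/

namespace CoxeterSystem

variable {n : ℕ} {M : CoxeterMatrix (Fin n)} {W : Type*} [Group W] (cs : CoxeterSystem M W)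

theorem commute_simple_of_not_adj {i j : Fin n} (h : ¬ cs.diagram.Adj i j) :
    Commute (cs.simple i) (cs.simple j) := by
  by_cases hij : i = j
  · rw [hij]
  have h2 : M i j = 2 := by
    by_contra h2
    exact h ⟨hij, h2⟩
  have h1 := cs.simple_mul_simple_pow i j
  rw [h2, pow_two, mul_eq_one_iff_eq_inv] at h1
  rw [commute_iff_eq]
  simpa using h1

/-- In the diagram of a finite Coxeter group, every nonempty set of nodes contains a node with at
most one neighbor in that set. -/
theorem exists_leaf [Finite W] (I : Finset (Fin n)) (hI : I.Nonempty) :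
    ∃ i ∈ I, ∀ j ∈ I, ∀ k ∈ I, cs.diagram.Adj i j → cs.diagram.Adj i k → j = k := by
  by_contra! hcon
  -- If every node of I had two neighbors in I, each row sum over I would be at most 1 - 1/2 - 1/2 =
  -- 0, and the form would not be positive on the indicator vector of I.
  set v : Fin n → ℝ := fun i => if i ∈ I then 1 else 0 with hv
  have hv0 : v ≠ 0 := by
    obtain ⟨i, hi⟩ := hI
    intro h
    simpa [hv, hi] using congrFun h i
  have hpos := cs.bilin_self_pos hv0
  have hle : M.bilin v v ≤ 0 := by
    rw [CoxeterMatrix.bilin]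
    refine Finset.sum_nonpos fun i _ => ?_
    by_cases hi : i ∈ I
    swap
    · simp [hv, hi]
    obtain ⟨j, hj, k, hk, hij, hik, hjk⟩ := hcon i hi
    have hform : M.form i v = ∑ l ∈ I, M.cosine i l := by
      rw [M.form_apply]; simp [hv]
    have hsub : ({i, j, k} : Finset (Fin n)) ⊆ I := by
      intro l; simp only [Finset.mem_insert, Finset.mem_singleton]
      rintro (rfl | rfl | rfl) <;> assumption
    have hrest : ∑ l ∈ I \ {i, j, k}, M.cosine i l ≤ 0 := by
      refine Finset.sum_nonpos fun l hl => M.cosine_nonpos ?_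
      rintro rfl
      simp at hl
    have h3 : ∑ l ∈ ({i, j, k} : Finset (Fin n)), M.cosine i l ≤ 0 := by
      rw [Finset.sum_insert (by simp [hij.ne, hik.ne]), Finset.sum_pair hjk, M.cosine_self]
      have := M.cosine_le_neg_half hij.1 hij.2
      have := M.cosine_le_neg_half hik.1 hik.2
      linarith
    have := Finset.sum_sdiff (f := fun l => M.cosine i l) hsub
    simp only [hv, hi, if_true, one_mul]
    rw [← hv, hform]
    linarith
  linarith

/-- Every node on a cycle has two neighbors on that cycle. -/
theorem diagram_isAcyclic [Finite W] : cs.diagram.IsAcyclic := by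
  intro u p hp
  obtain ⟨i, hi, h⟩ := cs.exists_leaf p.support.toFinset ⟨u, by simp⟩
  rw [List.mem_toFinset] at hi
  have h2 := hp.ncard_neighborSet_toSubgraph_eq_two hi
  obtain ⟨j, k, hjk, he⟩ := Set.ncard_eq_two.1 h2
  have hj : p.toSubgraph.Adj i j := by
    rw [← SimpleGraph.Subgraph.mem_neighborSet, he]; simp
  have hk : p.toSubgraph.Adj i k := by
    rw [← SimpleGraph.Subgraph.mem_neighborSet, he]; simp
  refine hjk (h j ?_ k ?_ hj.adj_sub hk.adj_sub)
  · simpa using hj.snd_mem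
  · simpa using hk.snd_mem

/-- The equivalence relation on words that is generated by rotations and by exchanging neighboring
letters that commute. -/
inductive RotationEquiv : List (Fin n) → List (Fin n) → Prop
  | refl (l) : RotationEquiv l l
  | symm {l l'} : RotationEquiv l l' → RotationEquiv l' l
  | trans {l l' l''} : RotationEquiv l l' → RotationEquiv l' l'' → RotationEquiv l l''
  | swap (a b x y) : Commute (cs.simple x) (cs.simple y) →
      RotationEquiv (a ++ x :: y :: b) (a ++ y :: x :: b)
  | rotate (x l) : RotationEquiv (x :: l) (l ++ [x])

namespace RotationEquiv

variable {cs} {l l' : List (Fin n)}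

theorem perm (h : cs.RotationEquiv l l') : l.Perm l' := by
  induction h with
  | refl => rfl
  | symm _ ih => exact ih.symm
  | trans _ _ ih ih' => exact ih.trans ih'
  | swap a b x y _ => exact (List.Perm.swap y x b).append_left a
  | rotate x l => exact (List.perm_append_singleton x l).symm

theorem isConj (h : cs.RotationEquiv l l') : IsConj (cs.wordProd l) (cs.wordProd l') := by
  induction h with
  | refl => exact IsConj.refl _
  | symm _ ih => exact ih.symm
  | trans _ _ ih ih' => exact ih.trans ih'
  | swap a b x y h =>
    simp only [wordProd_append, wordProd_cons]
    rw [← mul_assoc (cs.simple x), h.eq, mul_assoc]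
  | rotate x l =>
    rw [isConj_iff]
    refine ⟨(cs.simple x)⁻¹, ?_⟩
    simp [wordProd_append, wordProd_cons]

theorem append_comm (a b : List (Fin n)) : cs.RotationEquiv (a ++ b) (b ++ a) := by
  induction a generalizing b with
  | nil => simpa using refl b
  | cons x a ih =>
    have h1 := rotate (cs := cs) x (a ++ b)
    have h2 := ih (b ++ [x])
    simp only [List.append_assoc, List.cons_append, List.nil_append] at h1 h2 ⊢
    exact h1.trans h2

theorem move (i : Fin n) (a c d : List (Fin n))
    (h : ∀ x ∈ c, Commute (cs.simple x) (cs.simple i)) :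
    cs.RotationEquiv (a ++ (c ++ i :: d)) (a ++ i :: (c ++ d)) := by
  induction c generalizing a with
  | nil => exact refl _
  | cons x c ih =>
    have h1 := ih (a ++ [x]) fun y hy => h y (List.mem_cons_of_mem _ hy)
    have h2 := swap (cs := cs) a (c ++ d) x i (h x List.mem_cons_self)
    simp only [List.append_assoc, List.cons_append, List.nil_append] at h1 h2 ⊢
    exact h1.trans h2

/-- Insert `i` after every occurrence of `j`. -/
def insertAfter (j i : Fin n) (l : List (Fin n)) : List (Fin n) :=
  l.flatMap fun x => if x = j then [j, i] else [x]

theorem insertAfter_of_notMem {j i : Fin n} (h : j ∉ l) : insertAfter j i l = l := by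
  induction l with
  | nil => rfl
  | cons x l ih =>
    simp only [List.mem_cons, not_or] at h
    have := ih h.2
    rw [insertAfter] at this ⊢
    simp [List.flatMap_cons, this, Ne.symm h.1]

/-- Letters other than j commute with i. Hence a letter that can be exchanged with j can be
exchanged with the block j, i. -/
theorem map_insertAfter {j i : Fin n} (h : cs.RotationEquiv l l')
    (hi : ∀ x ∈ l, x ≠ j → Commute (cs.simple x) (cs.simple i)) :
    cs.RotationEquiv (insertAfter j i l) (insertAfter j i l') := by
  induction h with
  | refl => exact refl _
  | symm h ih => exact (ih fun x hx => hi x (h.perm.mem_iff.1 hx)).symm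
  | trans h h' ih ih' => exact (ih hi).trans (ih' fun x hx => hi x (h.perm.mem_iff.2 hx))
  | swap a b x y h =>
    simp only [insertAfter, List.flatMap_append, List.flatMap_cons]
    generalize (List.flatMap _ a) = a'
    generalize (List.flatMap _ b) = b'
    by_cases hxy : x = y
    · rw [hxy]; exact refl _
    by_cases hx : x = j
    · have hyj : y ≠ j := fun hy => hxy (hx.trans hy.symm)
      have hy := hi y (by simp) hyj
      simp only [hx, hyj, if_true, if_false, List.cons_append, List.nil_append]
      have h1 := swap (cs := cs) (a' ++ [j]) b' i y hy.symm
      have h2 := swap (cs := cs) a' (i :: b') j y (hx ▸ h)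
      simp only [List.append_assoc, List.cons_append, List.nil_append] at h1 h2 ⊢
      exact h1.trans h2
    by_cases hy : y = j
    · have hx' := hi x (by simp) hx
      simp only [hx, hy, if_true, if_false, List.cons_append, List.nil_append]
      have h1 := swap (cs := cs) a' (i :: b') x j (hy ▸ h)
      have h2 := swap (cs := cs) (a' ++ [j]) b' x i hx'
      simp only [List.append_assoc, List.cons_append, List.nil_append] at h1 h2 ⊢
      exact h1.trans h2
    · simp only [hx, hy, if_false, List.cons_append, List.nil_append]
      exact swap _ _ _ _ h
  | rotate x l =>
    simp only [insertAfter, List.flatMap_append, List.flatMap_cons, List.flatMap_nil,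
      List.append_nil]
    exact append_comm _ _

/-- Rotate j to the front; then i commutes with everything between j and itself and can be moved
next to j. -/
theorem exists_insertAfter {i j : Fin n} (hij : i ≠ j) (hl : l.Nodup) (hil : i ∈ l) (hjl : j ∈ l)
    (hi : ∀ x ∈ l, x ≠ j → Commute (cs.simple x) (cs.simple i)) :
    ∃ m, cs.RotationEquiv l (insertAfter j i m) ∧ l.Perm (i :: m) := by
  obtain ⟨a, b, rfl⟩ := List.append_of_mem hjl
  have h1 : cs.RotationEquiv (a ++ j :: b) (j :: (b ++ a)) := append_comm a (j :: b)
  have hnd : (j :: (b ++ a)).Nodup := h1.perm.nodup_iff.1 hl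
  have him : i ∈ b ++ a := by
    have := h1.perm.mem_iff.1 hil
    simpa [hij] using this
  generalize b ++ a = e at h1 hnd him
  obtain ⟨c, d, rfl⟩ := List.append_of_mem him
  have hj : j ∉ c ++ d := by
    intro hj
    refine (List.nodup_cons.1 hnd).1 ?_
    simp only [List.mem_append, List.mem_cons] at hj ⊢
    tauto
  refine ⟨j :: (c ++ d), ?_, ?_⟩
  · have h2 := move (cs := cs) i [j] c d fun x hx => hi x (h1.perm.mem_iff.2 (by simp [hx]))
      (by rintro rfl; exact hj (by simp [hx]))
    rw [insertAfter, List.flatMap_cons, if_pos rfl, ← insertAfter, insertAfter_of_notMem hj]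
    exact h1.trans h2
  · refine h1.perm.trans ?_
    refine (List.Perm.cons j List.perm_middle).trans (List.Perm.swap i j _)

end RotationEquiv

/-- Induction on the length: a leaf i commutes with all letters but its neighbor j, so in both words
i can be glued to j and then dropped. If i has no neighbor in the word, any other letter serves as
j. -/
theorem rotationEquiv_of_perm [Finite W] {l l' : List (Fin n)} (hl : l.Nodup) (h : l.Perm l') :
    cs.RotationEquiv l l' := by
  induction hN : l.length using Nat.strong_induction_on generalizing l l' with
  | _ N ih =>
  rcases eq_or_ne l [] with rfl | hne
  · rw [List.nil_perm.1 h]; exact .refl _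
  obtain ⟨i, hi, hleaf⟩ := cs.exists_leaf l.toFinset (l.toFinset_nonempty_iff.2 hne)
  simp only [List.mem_toFinset] at hi hleaf
  by_cases hall : ∀ x ∈ l, x = i
  · have e : l = [i] := by
      have := List.eq_replicate_of_mem hall
      rw [this] at hl
      rw [List.nodup_replicate] at hl
      have : l.length ≠ 0 := by
        intro h0
        rw [List.length_eq_zero_iff] at h0
        simp [h0] at hi
      rw [‹l = _›, show l.length = 1 by omega]; rfl
    subst e
    rw [List.singleton_perm.1 h]
    exact .refl _
  push Not at hall
  obtain ⟨j, hjl, hji, hj⟩ : ∃ j ∈ l, j ≠ i ∧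
      ∀ x ∈ l, x ≠ j → Commute (cs.simple x) (cs.simple i) := by
    by_cases hex : ∃ j ∈ l, cs.diagram.Adj i j
    · obtain ⟨j, hj, hadj⟩ := hex
      refine ⟨j, hj, hadj.ne', fun x hx hxj => cs.commute_simple_of_not_adj fun hadj' => hxj ?_⟩
      exact hleaf x hx j hj hadj'.symm hadj
    · push Not at hex
      obtain ⟨j, hj, hji⟩ := hall
      exact ⟨j, hj, hji, fun x hx _ =>
        cs.commute_simple_of_not_adj fun hadj => hex x hx hadj.symm⟩
  obtain ⟨m, hm, hpm⟩ := RotationEquiv.exists_insertAfter hji.symm hl hi hjl hj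
  obtain ⟨m', hm', hpm'⟩ := RotationEquiv.exists_insertAfter (cs := cs) hji.symm
    (h.nodup_iff.1 hl) (h.mem_iff.1 hi) (h.mem_iff.1 hjl) fun x hx => hj x (h.mem_iff.2 hx)
  have hmm : m.Perm m' := (hpm.symm.trans (h.trans hpm')).cons_inv
  have hlen := hpm.length_eq
  rw [List.length_cons] at hlen
  have hR := ih m.length (by omega) (List.nodup_cons.1 (hpm.nodup_iff.1 hl)).2 hmm rfl
  exact (hm.trans (hR.map_insertAfter fun x hx =>
    hj x (hpm.mem_iff.2 (List.mem_cons_of_mem _ hx)))).trans hm'.symm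

theorem orderOf_wordProd_eq_of_perm [Finite W] {l l' : List (Fin n)} (hl : l.Nodup)
    (h : l.Perm l') : orderOf (cs.wordProd l) = orderOf (cs.wordProd l') := by
  obtain ⟨g, hg⟩ := isConj_iff.1 (cs.rotationEquiv_of_perm hl h).isConj
  rw [← hg, ← MulAut.conj_apply, MulEquiv.orderOf_eq]

theorem coxeterElement_eq_wordProd (δ : Equiv.Perm (Fin n)) :
    cs.coxeterElement δ = cs.wordProd (List.ofFn δ) := by
  rw [coxeterElement, wordProd, List.map_ofFn]; rfl

theorem nodup_ofFn_perm (δ : Equiv.Perm (Fin n)) : (List.ofFn δ).Nodup :=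
  List.nodup_ofFn.2 δ.injective

theorem orderOf_coxeterElement [Finite W] (δ : Equiv.Perm (Fin n)) :
    orderOf (cs.coxeterElement δ) = cs.coxeterNumber := by
  rw [coxeterNumber, coxeterElement_eq_wordProd, coxeterElement_eq_wordProd]
  refine cs.orderOf_wordProd_eq_of_perm (nodup_ofFn_perm δ) ?_
  rw [List.perm_ext_iff_of_nodup (nodup_ofFn_perm δ) (nodup_ofFn_perm 1)]
  intro i
  simp [List.mem_ofFn, δ.surjective i]

end CoxeterSystem

/-! ### Powers of a Coxeter element in maximal parabolic subgroups -/

namespace CoxeterSystem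

section Weight

theorem bilin_sub_right {B : Type*} [Fintype B] {M : CoxeterMatrix B}
    (u v w : B → ℝ) : M.bilin u (v - w) = M.bilin u v - M.bilin u w := by
  simp [CoxeterMatrix.bilin, mul_sub]

variable {B : Type*} [Fintype B] [DecidableEq B] {M : CoxeterMatrix B} {W : Type*} [Group W]
  (cs : CoxeterSystem M W)

include cs in
/-- The fundamental weights: the basis dual to the simple roots. -/
theorem exists_weight [Finite W] (k : B) : ∃ ω : B → ℝ, ∀ v, M.bilin ω v = v k := by
  have hinj : Function.Injective (LinearMap.pi M.form) := by
    rw [← LinearMap.ker_eq_bot, LinearMap.ker_eq_bot']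
    intro v hv
    by_contra h0
    have := cs.bilin_self_pos h0
    have hz : M.bilin v v = 0 :=
      Finset.sum_eq_zero fun i _ => by rw [show M.form i v = 0 from congrFun hv i, mul_zero]
    linarith
  obtain ⟨ω, hω⟩ := LinearMap.injective_iff_surjective.1 hinj (Pi.single k 1)
  refine ⟨ω, fun v => ?_⟩
  rw [M.bilin_comm, CoxeterMatrix.bilin]
  have : ∀ i, M.form i ω = (Pi.single k 1 : B → ℝ) i := fun i => congrFun hω i
  simp [this, Pi.single_apply]

theorem geomRep_wordProd_apply_of_notMem {l : List B} {j : B} (hj : j ∉ l) (v : B → ℝ) :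
    cs.geomRep (cs.wordProd l) v j = v j := by
  induction l with
  | nil => simp
  | cons a l ih =>
    simp only [List.mem_cons, not_or] at hj
    rw [wordProd_cons, geomRep_mul_apply, geomRep_simple, M.geomReflection_apply_of_ne hj.1,
      ih hj.2]

/-- If no node outside `J ∪ K` is joined to `K` and the image under a word without repetitions of
a vector supported in `K` vanishes on `J`, then it is supported in `K`. -/
theorem geomRep_wordProd_supported {J K : Set B} (hJK : ∀ a ∈ K, a ∉ J)
    (hcos : ∀ a ∉ J, a ∉ K → ∀ b ∈ K, M.cosine a b = 0) {l : List B} (hl : l.Nodup)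
    {u : B → ℝ} (hu : ∀ a ∉ K, u a = 0)
    (hJ : ∀ a ∈ J, cs.geomRep (cs.wordProd l) u a = 0) :
    ∀ a ∉ K, cs.geomRep (cs.wordProd l) u a = 0 := by
  induction l with
  | nil => simpa using hu
  | cons i l ih =>
    rw [List.nodup_cons] at hl
    rw [wordProd_cons, geomRep_mul_apply, geomRep_simple] at hJ ⊢
    -- Since i occurs only once, coordinate i still has its value in u before s_i acts; the other
    -- coordinates have their final values already.
    have hq := ih hl.2 fun a ha => by
      by_cases hai : a = i
      · subst hai
        rw [cs.geomRep_wordProd_apply_of_notMem hl.1]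
        exact hu a fun h => hJK a h ha
      · rw [← hJ a ha, M.geomReflection_apply_of_ne hai]
    generalize cs.geomRep (cs.wordProd l) u = q at hJ hq
    intro a ha
    by_cases hai : a = i
    · subst hai
      by_cases haJ : a ∈ J
      · exact hJ a haJ
      · rw [M.geomReflection_apply_self, hq a ha, M.form_apply, Finset.sum_eq_zero]
        · simp
        · intro b _
          by_cases hb : b ∈ K
          · rw [hcos a haJ ha b hb, zero_mul]
          · rw [hq b hb, mul_zero]
    · rw [M.geomReflection_apply_of_ne hai, hq a ha]

/-- In the situation of `geomRep_wordProd_supported`, if `j ∈ J` is joined only to the node `k`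
of `K`, then the coordinate `k` vanishes before or after the word is applied. -/
theorem geomRep_wordProd_coord_eq_zero {J K : Set B} (hJK : ∀ a ∈ K, a ∉ J)
    (hcos : ∀ a ∉ J, a ∉ K → ∀ b ∈ K, M.cosine a b = 0) {l : List B} (hl : l.Nodup)
    {j k : B} (hjl : j ∈ l) (hjJ : j ∈ J) (hjk : M.cosine j k ≠ 0) (hkj : k ≠ j)
    (huniq : ∀ b ∈ K, b ≠ k → M.cosine j b = 0) :
    (∀ u : B → ℝ, (∀ a ∉ K, u a = 0) → (∀ a ∈ J, cs.geomRep (cs.wordProd l) u a = 0) → u k = 0) ∨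
    (∀ u : B → ℝ, (∀ a ∉ K, u a = 0) → (∀ a ∈ J, cs.geomRep (cs.wordProd l) u a = 0) →
      cs.geomRep (cs.wordProd l) u k = 0) := by
  -- Coordinate j is 0 both before and after s_j acts, so the form of α_j vanishes on the
  -- intermediate vector. That vector is supported in K, where only k is joined to j, so its
  -- coordinate k is 0. This is the final value if k occurs in `l₂`, and the initial one otherwise.
  obtain ⟨l₁, l₂, rfl⟩ := List.append_of_mem hjl
  have hnd := List.nodup_append.1 hl
  have hnd2 := List.nodup_cons.1 hnd.2.1
  have hsplit : ∀ u, cs.geomRep (cs.wordProd (l₁ ++ j :: l₂)) u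
      = cs.geomRep (cs.wordProd l₁)
        (M.geomReflection j (cs.geomRep (cs.wordProd l₂) u)) := fun u => by
    rw [wordProd_append, wordProd_cons, geomRep_mul_apply, geomRep_mul_apply, geomRep_simple]
  have hlast : ∀ u, ∀ a ∈ l₂, cs.geomRep (cs.wordProd (l₁ ++ j :: l₂)) u a
      = cs.geomRep (cs.wordProd l₂) u a := fun u a ha => by
    rw [hsplit, cs.geomRep_wordProd_apply_of_notMem, M.geomReflection_apply_of_ne]
    · rintro rfl; exact hnd2.1 ha
    · intro ha'
      exact hnd.2.2 a ha' a (List.mem_cons_of_mem _ ha) rfl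
  have hmid : ∀ u : B → ℝ, (∀ a ∉ K, u a = 0) →
      (∀ a ∈ J, cs.geomRep (cs.wordProd (l₁ ++ j :: l₂)) u a = 0) →
      cs.geomRep (cs.wordProd l₂) u k = 0 := by
    intro u hu hJ
    have hq := cs.geomRep_wordProd_supported hJK hcos hnd2.2 hu fun a ha => by
      by_cases hal : a ∈ l₂
      · rw [← hlast u a hal, hJ a ha]
      · rw [cs.geomRep_wordProd_apply_of_notMem hal]
        exact hu a fun h => hJK a h ha
    have h0 := hJ j hjJ
    rw [hsplit, cs.geomRep_wordProd_apply_of_notMem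
      (fun h => hnd.2.2 j h j List.mem_cons_self rfl)] at h0
    generalize cs.geomRep (cs.wordProd l₂) u = q at hq h0
    rw [M.geomReflection_apply_self, hq j fun h => hJK j h hjJ, M.form_apply,
      Finset.sum_eq_single k] at h0
    · simpa [hjk] using h0
    · intro b _ hbk
      by_cases hb : b ∈ K
      · rw [huniq b hb hbk, zero_mul]
      · rw [hq b hb, mul_zero]
    · simp
  by_cases hk : k ∈ l₂
  · exact Or.inr fun u hu hJ => by rw [hlast u k hk, hmid u hu hJ]
  · exact Or.inl fun u hu hJ => by
      rw [← cs.geomRep_wordProd_apply_of_notMem hk u, hmid u hu hJ]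

end Weight

variable {n : ℕ} {M : CoxeterMatrix (Fin n)} {W : Type*} [Group W] (cs : CoxeterSystem M W)

theorem cosine_eq_zero_of_not_adj {i j : Fin n} (hij : i ≠ j) (h : ¬ cs.diagram.Adj i j) :
    M.cosine i j = 0 := by
  refine M.cosine_eq_zero ?_
  by_contra h2
  exact h ⟨hij, h2⟩

/-- Two neighbors of `j` that are connected by a path avoiding `j` are equal. -/
theorem eq_of_adj_of_reflTransGen [Finite W] {j k k' : Fin n} {S : Set (Fin n)} (hjS : j ∉ S)
    (hk : k ∈ S) (hjk : cs.diagram.Adj j k) (hjk' : cs.diagram.Adj j k')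
    (h : Relation.ReflTransGen (fun a b => cs.diagram.Adj a b ∧ b ∈ S) k k') : k' = k := by
  by_contra hne
  -- The edge j k is a bridge of the forest, but j k' followed by the path back to k inside S would
  -- bypass it.
  have hb := SimpleGraph.isAcyclic_iff_forall_adj_isBridge.1 cs.diagram_isAcyclic hjk
  rw [SimpleGraph.isBridge_iff] at hb
  apply hb
  have key : ∀ b, Relation.ReflTransGen (fun a b => cs.diagram.Adj a b ∧ b ∈ S) k b →
      b ∈ S ∧ (cs.diagram.deleteEdges {s(j, k)}).Reachable b k := by
    intro b hb
    induction hb with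
    | refl => exact ⟨hk, SimpleGraph.Reachable.refl _⟩
    | @tail a b _ hab ih =>
      refine ⟨hab.2, SimpleGraph.Reachable.trans (SimpleGraph.Adj.reachable ?_) ih.2⟩
      rw [SimpleGraph.deleteEdges_adj]
      refine ⟨hab.1.symm, ?_⟩
      simp only [Set.mem_singleton_iff, Sym2.eq_iff]
      rintro (⟨rfl, rfl⟩ | ⟨rfl, rfl⟩)
      · exact hjS hab.2
      · exact hjS ih.1
  refine SimpleGraph.Reachable.trans (SimpleGraph.Adj.reachable ?_) (key k' h).2
  rw [SimpleGraph.deleteEdges_adj]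
  refine ⟨hjk', ?_⟩
  simp only [Set.mem_singleton_iff, Sym2.eq_iff]
  rintro (⟨-, h⟩ | ⟨h, -⟩)
  · exact hne h
  · exact hjk.ne h

/-- If a power of a Coxeter element fixes the fundamental weight of a node, then it fixes the
fundamental weights of the neighboring nodes. -/
theorem geomRep_pow_apply_of_adj [Finite W] {l : List (Fin n)} (hl : l.Nodup) (m : ℕ)
    {j k : Fin n} (hjl : j ∈ l) (hjk : cs.diagram.Adj j k)
    (hj : ∀ v, cs.geomRep (cs.wordProd l ^ m) v j = v j) :
    ∀ v, cs.geomRep (cs.wordProd l ^ m) v k = v k := by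
  -- Let ω be the fundamental weight of k and y = ω - c^m ω. With J the set of preserved coordinates
  -- and K the component of k outside J, all c^t y are supported in K. As j has no neighbor in K but
  -- k, this gives y k = 0, which forces y = 0.
  by_contra hkJ
  set c := cs.wordProd l with hc
  set J : Set (Fin n) := {j | ∀ v, cs.geomRep (c ^ m) v j = v j} with hJdef
  set K : Set (Fin n) :=
    {a | Relation.ReflTransGen (fun a b => cs.diagram.Adj a b ∧ b ∈ Jᶜ) k a} with hKdef
  have hjJ : j ∈ J := hj
  have hkK : k ∈ K := Relation.ReflTransGen.refl
  have hJK : ∀ a ∈ K, a ∉ J := by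
    intro a ha
    cases ha with
    | refl => exact hkJ
    | tail _ h => exact h.2
  have hcos : ∀ a ∉ J, a ∉ K → ∀ b ∈ K, M.cosine a b = 0 := by
    intro a haJ haK b hb
    refine cs.cosine_eq_zero_of_not_adj (by rintro rfl; exact haK hb) fun h => haK ?_
    exact Relation.ReflTransGen.tail hb ⟨h.symm, haJ⟩
  have huniq : ∀ b ∈ K, b ≠ k → M.cosine j b = 0 := by
    intro b hb hbk
    refine cs.cosine_eq_zero_of_not_adj (by rintro rfl; exact hJK _ hb hjJ) fun h => hbk ?_
    exact cs.eq_of_adj_of_reflTransGen (S := Jᶜ) (by simpa using hjJ) hkJ hjk h hb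
  have hcjk : M.cosine j k ≠ 0 := by
    have := M.cosine_le_neg_half hjk.1 hjk.2
    linarith
  obtain ⟨ω, hω⟩ := cs.exists_weight k
  have hformω : ∀ i, i ≠ k → M.form i ω = 0 := fun i hi => by
    rw [← M.bilin_single, M.bilin_comm, hω, Pi.single_eq_of_ne hi.symm]
  have hx : c ^ m ∈ Subgroup.closure (cs.simple '' Jᶜ) :=
    cs.mem_closure_of_geomRep_apply _ fun i hi v => by
      have : i ∈ J := by simpa using hi
      exact this v
  -- The property of mapping the affine space ω + ℝ^K into itself. Reflections in K alter only
  -- coordinates in K; the remaining ones outside J fix ω and are not joined to K.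
  let P : W → Prop := fun w => ∀ u : Fin n → ℝ, (∀ a ∉ K, u a = 0) →
    ∃ u' : Fin n → ℝ, (∀ a ∉ K, u' a = 0) ∧ cs.geomRep w (ω + u) = ω + u'
  have hsimple : ∀ i ∉ J, P (cs.simple i) := by
    intro i hi u hu
    by_cases hiK : i ∈ K
    · refine ⟨u - (2 * M.form i (ω + u)) • Pi.single i (1 : ℝ), fun a ha => ?_, ?_⟩
      · have hai : a ≠ i := by rintro rfl; exact ha hiK
        simp [hu a ha, hai]
      · rw [geomRep_simple, M.geomReflection_apply]; abel
    · refine ⟨u, hu, ?_⟩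
      rw [geomRep_simple, M.geomReflection_of_form_eq_zero]
      rw [map_add, hformω i (by rintro rfl; exact hiK hkK), M.form_apply, zero_add]
      refine Finset.sum_eq_zero fun b _ => ?_
      by_cases hb : b ∈ K
      · rw [hcos i hi hiK b hb, zero_mul]
      · rw [hu b hb, mul_zero]
  have hPmul : ∀ w w', P w → P w' → P (w * w') := by
    intro w w' h h' u hu
    obtain ⟨u', hu', e'⟩ := h' u hu
    obtain ⟨u'', hu'', e''⟩ := h u' hu'
    exact ⟨u'', hu'', by rw [geomRep_mul_apply, e', e'']⟩
  have hP : ∀ w ∈ Subgroup.closure (cs.simple '' Jᶜ), P w ∧ P w⁻¹ := by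
    intro w hw
    induction hw using Subgroup.closure_induction with
    | mem x hx =>
      obtain ⟨i, hi, rfl⟩ := hx
      rw [inv_simple]
      exact ⟨hsimple i hi, hsimple i hi⟩
    | one => rw [inv_one]; exact ⟨fun u hu => ⟨u, hu, by simp⟩, fun u hu => ⟨u, hu, by simp⟩⟩
    | mul x y _ _ hx hy =>
      rw [mul_inv_rev]
      exact ⟨hPmul _ _ hx.1 hy.1, hPmul _ _ hy.2 hx.2⟩
    | inv x _ hx => rw [inv_inv]; exact hx.symm
  set y := ω - cs.geomRep (c ^ m) ω with hy
  have hyK : ∀ a ∉ K, y a = 0 := by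
    obtain ⟨u', hu', e⟩ := (hP _ hx).1 0 (by simp)
    rw [add_zero] at e
    intro a ha
    rw [hy, e]
    simp [hu' a ha]
  -- c^t commutes with c^m, and c^m preserves the coordinates in J.
  have hyJ : ∀ t : ℕ, ∀ a ∈ J, cs.geomRep (c ^ t) y a = 0 := by
    intro t a ha
    rw [hy, map_sub, ← geomRep_mul_apply, ← pow_add, add_comm, pow_add, geomRep_mul_apply,
      Pi.sub_apply, show cs.geomRep (c ^ m) (cs.geomRep (c ^ t) ω) a = _ from ha _, sub_self]
  have hyJ' : ∀ t : ℕ, ∀ a ∈ J, cs.geomRep c (cs.geomRep (c ^ t) y) a = 0 := by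
    intro t a ha
    rw [← geomRep_mul_apply, ← pow_succ']
    exact hyJ (t + 1) a ha
  have hzK : ∀ t : ℕ, ∀ a ∉ K, cs.geomRep (c ^ t) y a = 0 := by
    intro t
    induction t with
    | zero => simpa using hyK
    | succ t ih =>
      rw [pow_succ', geomRep_mul_apply]
      exact cs.geomRep_wordProd_supported hJK hcos hl ih (hyJ' t)
  have hyk : y k = 0 := by
    rcases cs.geomRep_wordProd_coord_eq_zero hJK hcos hl hjl hjJ hcjk hjk.ne' huniq with h | h
    · exact h y hyK (by simpa using hyJ' 0)
    -- As c has finite order, y is itself the image under c of a vector c^t y.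
    · have hpos := orderOf_pos c
      have := h (cs.geomRep (c ^ (orderOf c - 1)) y) (hzK _) (hyJ' _)
      rwa [← hc, ← geomRep_mul_apply, ← pow_succ', Nat.sub_add_cancel hpos, pow_orderOf_eq_one,
        map_one, Module.End.one_apply] at this
  -- Invariance of the form gives B(y, y) = 2 B(ω, ω - c^m ω) = 2 B(ω, y), and B(ω, y) is the
  -- coordinate k of y.
  have hy0 : y = 0 := by
    by_contra hne
    have hpos := cs.bilin_self_pos hne
    have h1 : M.bilin ω y = 0 := by rw [hω, hyk]
    have h2 : M.bilin y y = 2 * M.bilin ω y := by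
      have e1 : M.bilin y y = M.bilin ω y - M.bilin (cs.geomRep (c ^ m) ω) y := by
        rw [M.bilin_comm y y]
        conv_lhs => rw [hy, bilin_sub_right, ← hy]
        rw [M.bilin_comm y, M.bilin_comm y]
      have e2 : M.bilin (cs.geomRep (c ^ m) ω) y
          = M.bilin (cs.geomRep (c ^ m) ω) ω - M.bilin ω ω := by
        rw [hy, bilin_sub_right, bilin_geomRep]
      have e3 : M.bilin ω y = M.bilin ω ω - M.bilin (cs.geomRep (c ^ m) ω) ω := by
        rw [hy, bilin_sub_right, M.bilin_comm ω (cs.geomRep (c ^ m) ω)]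
      linarith
    linarith
  apply hkJ
  intro v
  have hxω : cs.geomRep (c ^ m) ω = ω := (sub_eq_zero.1 hy0).symm
  rw [← hω (cs.geomRep (c ^ m) v), ← hω v, ← cs.bilin_geomRep (c ^ m) ω v, hxω]

theorem wordProd_mem_closure {I : Set (Fin n)} {l : List (Fin n)} (h : ∀ i ∈ l, i ∈ I) :
    cs.wordProd l ∈ Subgroup.closure (cs.simple '' I) := by
  refine Subgroup.list_prod_mem _ fun x hx => ?_
  obtain ⟨i, hi, rfl⟩ := List.mem_map.1 hx
  exact Subgroup.subset_closure ⟨i, h i hi, rfl⟩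

theorem commute_wordProd {l l' : List (Fin n)}
    (h : ∀ i ∈ l, ∀ j ∈ l', Commute (cs.simple i) (cs.simple j)) :
    Commute (cs.wordProd l) (cs.wordProd l') := by
  refine Commute.list_prod_left _ _ fun x hx => Commute.list_prod_right _ _ fun y hy => ?_
  obtain ⟨i, hi, rfl⟩ := List.mem_map.1 hx
  obtain ⟨j, hj, rfl⟩ := List.mem_map.1 hy
  exact h i hi j hj

theorem wordProd_filter_mul_filter (p : Fin n → Prop) [DecidablePred p]
    (h : ∀ i j, p i → ¬ p j → Commute (cs.simple i) (cs.simple j)) (l : List (Fin n)) :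
    cs.wordProd (l.filter (fun i => p i)) * cs.wordProd (l.filter (fun i => ¬ p i))
      = cs.wordProd l := by
  induction l with
  | nil => simp
  | cons i l ih =>
    by_cases hi : p i
    · simp [hi, wordProd_cons, mul_assoc, ← ih]
    · have hcomm : Commute (cs.wordProd (l.filter (fun i => p i))) (cs.simple i) := by
        simpa using cs.commute_wordProd (l := l.filter (fun i => p i)) (l' := [i])
          fun a ha b hb => by
            rw [List.mem_singleton.1 hb]
            exact h a i (by simpa using (List.mem_filter.1 ha).2) hi
      simp only [hi, decide_false, Bool.false_eq_true, not_false_eq_true, List.filter_cons_of_neg,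
        decide_true, List.filter_cons_of_pos, wordProd_cons, ← ih]
      rw [← mul_assoc, hcomm.eq, mul_assoc]

/-- The power preserves coordinate i, hence all coordinates in the component C of i. Write s_δ as a
commuting product of a part on C and a part off C: the m-th power of the first part lies in the
parabolic subgroups of C and of its complement, so it is trivial. -/
theorem componentCoxeterNumber_dvd [Finite W] (δ : Equiv.Perm (Fin n)) (m : ℕ) (i : Fin n)
    (h : cs.coxeterElement δ ^ m ∈ cs.maxParabolic i) : cs.componentCoxeterNumber i ∣ m := by
  classical
  rw [coxeterElement_eq_wordProd] at h
  set l := List.ofFn δ with hl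
  have hlnd : l.Nodup := nodup_ofFn_perm δ
  have hmem : ∀ j, j ∈ l := fun j => by simp [hl, List.mem_ofFn, δ.surjective j]
  have hi : ∀ v, cs.geomRep (cs.wordProd l ^ m) v i = v i :=
    cs.geomRep_apply_of_mem_closure h (by simp)
  have hC : ∀ j, cs.diagram.Reachable i j → ∀ v, cs.geomRep (cs.wordProd l ^ m) v j = v j := by
    rintro j ⟨p⟩
    clear h
    induction p with
    | nil => exact hi
    | cons hadj p ih => exact ih (cs.geomRep_pow_apply_of_adj hlnd m (hmem _) hadj hi)
  set C : Set (Fin n) := {j | cs.diagram.Reachable i j} with hCdef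
  have hcomm : ∀ a b, a ∈ C → b ∉ C → Commute (cs.simple a) (cs.simple b) := fun a b ha hb =>
    cs.commute_simple_of_not_adj fun hadj => hb (SimpleGraph.Reachable.trans ha hadj.reachable)
  have hprod := cs.wordProd_filter_mul_filter (· ∈ C) hcomm l
  set l₁ := l.filter (fun j => j ∈ C) with hl₁
  set l₂ := l.filter (fun j => ¬ j ∈ C) with hl₂
  have hmem₁ : ∀ j ∈ l₁, j ∈ C := fun j hj => by simpa using (List.mem_filter.1 hj).2
  have hmem₂ : ∀ j ∈ l₂, j ∈ Cᶜ := fun j hj => by simpa using (List.mem_filter.1 hj).2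
  have hcomm₁₂ : Commute (cs.wordProd l₁) (cs.wordProd l₂) :=
    cs.commute_wordProd fun a ha b hb => hcomm a b (hmem₁ a ha) (hmem₂ b hb)
  have hx : cs.wordProd l ^ m ∈ Subgroup.closure (cs.simple '' Cᶜ) :=
    cs.mem_closure_of_geomRep_apply _ fun j hj => hC j (not_not.1 hj)
  rw [← hprod, hcomm₁₂.mul_pow, Subgroup.mul_mem_cancel_right _
    (pow_mem (cs.wordProd_mem_closure hmem₂) m)] at hx
  have hx' := pow_mem (cs.wordProd_mem_closure hmem₁) m
  have hone : cs.wordProd l₁ ^ m = 1 := by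
    refine cs.eq_one_of_geomRep fun v => funext fun j => ?_
    by_cases hj : j ∈ C
    · exact cs.geomRep_apply_of_mem_closure hx (by simpa using hj) v
    · exact cs.geomRep_apply_of_mem_closure hx' hj v
  have horder : cs.componentCoxeterNumber i = orderOf (cs.wordProd l₁) := by
    rw [componentCoxeterNumber]
    refine cs.orderOf_wordProd_eq_of_perm ((List.nodup_finRange n).filter _) ?_
    rw [List.perm_ext_iff_of_nodup ((List.nodup_finRange n).filter _) (hlnd.filter _)]
    intro j
    simp [hmem j, hCdef]
  rw [horder]
  exact orderOf_dvd_of_pow_eq_one hone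

end CoxeterSystem

/-! ### Flags of the Coxeter complex as pairs (w, δ) -/

namespace AbstractSimplicialComplex.CompleteFlag

variable {V : Type*} {K : AbstractSimplicialComplex V} {n : ℕ}

theorem sigma_eq_of_unique {i : Fin n} {F G : CompleteFlag K n} (h : G.face i ≠ F.face i)
    (h' : ∀ j, j ≠ i → G.face j = F.face j)
    (huniq : ∀ G' : CompleteFlag K n, G'.face i ≠ F.face i →
      (∀ j, j ≠ i → G'.face j = F.face j) → G' = G) : sigma i F = G := by
  have hex : ∃ F' : CompleteFlag K n, F'.face i ≠ F.face i ∧ ∀ j, j ≠ i → F'.face j = F.face j :=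
    ⟨G, h, h'⟩
  rw [sigma, dif_pos hex]
  exact huniq _ hex.choose_spec.1 hex.choose_spec.2

theorem face_eq_of_subset {F G : CompleteFlag K n} {i : Fin n} (h : F.face i ⊆ G.face i) :
    F.face i = G.face i :=
  Finset.eq_of_subset_of_card_le h (by rw [F.card_face, G.card_face])

/-- Every face of a flag contains a vertex that is not in the smaller faces. -/
theorem exists_mem_face_notMem (F : CompleteFlag K n) (k : Fin n) :
    ∃ v ∈ F.face k, ∀ j < k, v ∉ F.face j := by
  by_cases hk : (k : ℕ) = 0
  · obtain ⟨v, hv⟩ := (K.isRelLowerSet_faces (F.face_mem k)).1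
    refine ⟨v, hv, fun j hj => ?_⟩
    rw [Fin.lt_def] at hj
    omega
  · let p : Fin n := ⟨k - 1, by omega⟩
    have hlt : (F.face p).card < (F.face k).card := by
      rw [F.card_face, F.card_face]; simp only [p]; omega
    obtain ⟨v, hv, hv'⟩ := Finset.exists_mem_notMem_of_card_lt_card hlt
    refine ⟨v, hv, fun j hj hvj => hv' (F.face_mono ?_ hvj)⟩
    rw [Fin.le_def]
    rw [Fin.lt_def] at hj
    simp only [p]; omega

end AbstractSimplicialComplex.CompleteFlag

namespace CoxeterSystem

open AbstractSimplicialComplex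

variable {n : ℕ} {M : CoxeterMatrix (Fin n)} {W : Type*} [Group W] (cs : CoxeterSystem M W)

theorem simple_mem_maxParabolic {i j : Fin n} (h : j ≠ i) : cs.simple j ∈ cs.maxParabolic i :=
  Subgroup.subset_closure ⟨j, h, rfl⟩

theorem geomRep_apply_of_mem_maxParabolic {i : Fin n} {w : W} (h : w ∈ cs.maxParabolic i)
    (v : Fin n → ℝ) : cs.geomRep w v i = v i :=
  cs.geomRep_apply_of_mem_closure h (by simp) v

theorem simple_notMem_maxParabolic (i : Fin n) : cs.simple i ∉ cs.maxParabolic i := by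
  intro h
  have := cs.geomRep_apply_of_mem_maxParabolic h (Pi.single i 1)
  rw [geomRep_simple, M.geomReflection_apply_self, M.form_single, M.cosine_self] at this
  norm_num at this

theorem eq_one_of_forall_mem_maxParabolic [Finite W] {w : W} (h : ∀ i, w ∈ cs.maxParabolic i) :
    w = 1 :=
  cs.eq_one_of_geomRep fun v => funext fun i => cs.geomRep_apply_of_mem_maxParabolic (h i) v

/-- All coordinates except j are preserved, so w lies in the subgroup generated by s_j. This is the
group-theoretic form of thinness. -/
theorem eq_one_or_eq_simple_of_forall_mem_maxParabolic [Finite W] {w : W} {j : Fin n}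
    (h : ∀ i ≠ j, w ∈ cs.maxParabolic i) : w = 1 ∨ w = cs.simple j := by
  have hw : w ∈ Subgroup.closure (cs.simple '' {j}) :=
    cs.mem_closure_of_geomRep_apply w fun i hi v =>
      cs.geomRep_apply_of_mem_maxParabolic (h i hi) v
  rw [Set.image_singleton, Subgroup.mem_closure_singleton] at hw
  obtain ⟨k, rfl⟩ := hw
  have hsq : cs.simple j ^ (2 : ℤ) = 1 := by exact_mod_cast cs.simple_sq j
  rcases Int.even_or_odd' k with ⟨l, rfl | rfl⟩
  · left; rw [zpow_mul, hsq, one_zpow]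
  · right; rw [zpow_add, zpow_mul, hsq, one_zpow, one_mul, zpow_one]

theorem mem_parabolicCoset {w g : W} {i : Fin n} :
    g ∈ cs.parabolicCoset w i ↔ w⁻¹ * g ∈ cs.maxParabolic i := by
  constructor
  · rintro ⟨x, hx, rfl⟩
    simpa using hx
  · intro h
    exact ⟨_, h, by simp⟩

/-- A coset w W^i determines i: right multiplication by s_j preserves it for j ≠ i, but not for j =
i. -/
theorem vertex_eq_iff {w w' : W} {i j : Fin n} :
    cs.vertex w i = cs.vertex w' j ↔ i = j ∧ w⁻¹ * w' ∈ cs.maxParabolic i := by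
  constructor
  · intro h
    have h' : cs.parabolicCoset w i = cs.parabolicCoset w' j := congrArg Subtype.val h
    have hmem : ∀ g, w⁻¹ * g ∈ cs.maxParabolic i ↔ w'⁻¹ * g ∈ cs.maxParabolic j := fun g => by
      rw [← mem_parabolicCoset, ← mem_parabolicCoset, h']
    refine ⟨?_, (hmem w').2 (by simp)⟩
    by_contra hij
    apply cs.simple_notMem_maxParabolic i
    have h1 : w'⁻¹ * w ∈ cs.maxParabolic j := (hmem w).1 (by simp)
    have h2 := (hmem (w * cs.simple i)).2 (by
      rw [← mul_assoc]; exact mul_mem h1 (cs.simple_mem_maxParabolic hij))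
    simpa using h2
  · rintro ⟨rfl, h⟩
    apply Subtype.ext
    change cs.parabolicCoset w i = cs.parabolicCoset w' i
    ext g
    rw [mem_parabolicCoset, mem_parabolicCoset,
      show w⁻¹ * g = w⁻¹ * w' * (w'⁻¹ * g) by group, Subgroup.mul_mem_cancel_left _ h]

theorem vertex_mul_simple {w : W} {i j : Fin n} (h : j ≠ i) :
    cs.vertex (w * cs.simple j) i = cs.vertex w i := by
  rw [eq_comm, vertex_eq_iff]
  simpa using cs.simple_mem_maxParabolic h

theorem vertex_injective (w : W) : Function.Injective (cs.vertex w) := fun _ _ h =>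
  (cs.vertex_eq_iff.1 h).1

theorem mem_chamber {w : W} {X : cs.ComplexVertex} : X ∈ cs.chamber w ↔ ∃ i, cs.vertex w i = X := by
  simp [chamber]

theorem card_chamber (w : W) : (cs.chamber w).card = n := by
  classical
  rw [chamber, Finset.card_image_of_injective _ (cs.vertex_injective w), Finset.card_fin]

theorem vertex_mem_chamber_iff {w w' : W} {i : Fin n} :
    cs.vertex w i ∈ cs.chamber w' ↔ w⁻¹ * w' ∈ cs.maxParabolic i := by
  rw [mem_chamber]
  constructor
  · rintro ⟨j, hj⟩
    exact (cs.vertex_eq_iff.1 hj.symm).2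
  · intro h
    exact ⟨i, (cs.vertex_eq_iff.2 ⟨rfl, h⟩).symm⟩

theorem chamber_injective [Finite W] : Function.Injective cs.chamber := by
  intro w w' h
  have : w⁻¹ * w' = 1 := cs.eq_one_of_forall_mem_maxParabolic fun i => by
    rw [← vertex_mem_chamber_iff, ← h, mem_chamber]
    exact ⟨i, rfl⟩
  exact inv_mul_eq_one.1 this

theorem mem_faces_iff {A : Finset cs.ComplexVertex} :
    A ∈ cs.coxeterComplex.faces ↔ A.Nonempty ∧ ∃ w, A ⊆ cs.chamber w := by
  refine and_congr_right fun _ => exists_congr fun w => forall₂_congr fun X _ => ?_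
  rw [mem_chamber]
  exact exists_congr fun i => eq_comm

theorem chamber_mem_faces (hn : 0 < n) (w : W) : cs.chamber w ∈ cs.coxeterComplex.faces := by
  rw [mem_faces_iff]
  exact ⟨Finset.card_pos.1 (by rwa [card_chamber]), w, subset_rfl⟩

theorem isFacet_iff (hn : 0 < n) {A : Finset cs.ComplexVertex} :
    cs.coxeterComplex.IsFacet A ↔ ∃ w, A = cs.chamber w := by
  constructor
  · intro h
    obtain ⟨w, hw⟩ := (cs.mem_faces_iff.1 h.1).2
    exact ⟨w, h.eq_of_ge (cs.chamber_mem_faces hn w) hw |>.symm⟩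
  · rintro ⟨w, rfl⟩
    refine ⟨cs.chamber_mem_faces hn w, fun A hA hwA => ?_⟩
    obtain ⟨w', hw'⟩ := (cs.mem_faces_iff.1 hA).2
    have := Finset.eq_of_subset_of_card_le (hwA.trans hw') (by rw [card_chamber, card_chamber])
    exact this ▸ hw'

theorem coxeterComplex_isPure (hn : 0 < n) : cs.coxeterComplex.IsPure n := by
  intro A hA
  obtain ⟨w, rfl⟩ := (cs.isFacet_iff hn).1 hA
  exact cs.card_chamber w

theorem coxeterComplex_isThin [Finite W] (hn : 0 < n) : cs.coxeterComplex.IsThin n := by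
  classical
  intro R hR hcard
  obtain ⟨w, hw⟩ : ∃ w, R ⊆ cs.chamber w := by
    rcases hR with rfl | hR
    · exact ⟨1, Finset.empty_subset _⟩
    · exact (cs.mem_faces_iff.1 hR).2
  obtain ⟨X, hX, hRX⟩ : ∃ X ∈ cs.chamber w, X ∉ R :=
    Finset.exists_mem_notMem_of_card_lt_card (by rw [card_chamber]; omega)
  obtain ⟨j, rfl⟩ := cs.mem_chamber.1 hX
  have hRe : R = (cs.chamber w).erase (cs.vertex w j) := by
    refine Finset.eq_of_subset_of_card_le (fun Y hY => ?_) ?_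
    · exact Finset.mem_erase.2 ⟨fun h => hRX (h ▸ hY), hw hY⟩
    · rw [Finset.card_erase_of_mem hX, card_chamber]; omega
  have hset : {A : Finset cs.ComplexVertex | cs.coxeterComplex.IsFacet A ∧ R ⊆ A}
      = {cs.chamber w, cs.chamber (w * cs.simple j)} := by
    ext A
    simp only [Set.mem_ofPred_eq, Set.mem_insert_iff, Set.mem_singleton_iff]
    rw [cs.isFacet_iff hn]
    constructor
    · rintro ⟨⟨w', rfl⟩, hRw'⟩
      have := cs.eq_one_or_eq_simple_of_forall_mem_maxParabolic (w := w⁻¹ * w') (j := j)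
        fun i hij => by
          rw [← vertex_mem_chamber_iff]
          apply hRw'
          rw [hRe, Finset.mem_erase]
          exact ⟨fun h => hij (cs.vertex_injective w h), cs.mem_chamber.2 ⟨i, rfl⟩⟩
      rcases this with h | h
      · left; rw [inv_mul_eq_one.1 h]
      · right; rw [← h]; simp
    · have hsub : R ⊆ cs.chamber (w * cs.simple j) := by
        intro Y hY
        rw [hRe, Finset.mem_erase] at hY
        obtain ⟨i, rfl⟩ := cs.mem_chamber.1 hY.2
        have hij : j ≠ i := by rintro rfl; exact hY.1 rfl
        exact cs.mem_chamber.2 ⟨i, cs.vertex_mul_simple hij⟩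
      rintro (rfl | rfl)
      · exact ⟨⟨w, rfl⟩, hw⟩
      · exact ⟨⟨_, rfl⟩, hsub⟩
  rw [hset, Set.ncard_pair]
  intro h
  have h1 := cs.chamber_injective h
  have h2 : cs.simple j = 1 := by simpa using h1.symm
  exact cs.simple_notMem_maxParabolic j (h2 ▸ one_mem _)

open Classical in
/-- The flag of the vertices `w W^{δ(1)}, …, w W^{δ(n)}`. -/
noncomputable def mkFlag (w : W) (δ : Equiv.Perm (Fin n)) : CompleteFlag cs.coxeterComplex n where
  face k := (Finset.Iic k).image fun i => cs.vertex w (δ i)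
  face_mem k := by
    rw [mem_faces_iff]
    refine ⟨⟨cs.vertex w (δ k), Finset.mem_image.2 ⟨k, by simp, rfl⟩⟩, w, fun X hX => ?_⟩
    obtain ⟨i, -, rfl⟩ := Finset.mem_image.1 hX
    exact cs.mem_chamber.2 ⟨_, rfl⟩
  card_face k := by
    exact (Finset.card_image_of_injective _ ((cs.vertex_injective w).comp δ.injective)).trans
      (Fin.card_Iic k)
  face_mono k l hkl := Finset.image_subset_image (Finset.Iic_subset_Iic.2 hkl)

theorem mem_mkFlag_face {w : W} {δ : Equiv.Perm (Fin n)} {k : Fin n} {X : cs.ComplexVertex} :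
    X ∈ (cs.mkFlag w δ).face k ↔ ∃ i ≤ k, cs.vertex w (δ i) = X := by
  simp [mkFlag]

theorem vertex_mem_mkFlag_face {w : W} {δ : Equiv.Perm (Fin n)} {k i : Fin n} :
    cs.vertex w (δ i) ∈ (cs.mkFlag w δ).face k ↔ i ≤ k := by
  rw [mem_mkFlag_face]
  constructor
  · rintro ⟨j, hj, h⟩
    rwa [← δ.injective (cs.vertex_injective w h)]
  · exact fun h => ⟨i, h, rfl⟩

theorem mkFlag_face_last {k : Fin n} (hk : (k : ℕ) + 1 = n) (w : W) (δ : Equiv.Perm (Fin n)) :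
    (cs.mkFlag w δ).face k = cs.chamber w := by
  refine Finset.eq_of_subset_of_card_le (fun X hX => ?_) ?_
  · obtain ⟨i, -, rfl⟩ := cs.mem_mkFlag_face.1 hX
    exact cs.mem_chamber.2 ⟨_, rfl⟩
  · rw [card_chamber, (cs.mkFlag w δ).card_face, hk]

theorem mkFlag_face_zero {k : Fin n} (hk : (k : ℕ) = 0) (w : W) (δ : Equiv.Perm (Fin n)) :
    (cs.mkFlag w δ).face k = {cs.vertex w (δ k)} := by
  ext X
  rw [mem_mkFlag_face, Finset.mem_singleton]
  constructor
  · rintro ⟨i, hi, rfl⟩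
    have : i = k := Fin.ext (by rw [Fin.le_def] at hi; omega)
    rw [this]
  · rintro rfl
    exact ⟨k, le_rfl, rfl⟩

/-- The top face provides w, and δ(k) is the type of the vertex by which the k-face exceeds the
smaller faces. -/
theorem exists_eq_mkFlag (hn : 0 < n) (F : CompleteFlag cs.coxeterComplex n) :
    ∃ w δ, F = cs.mkFlag w δ := by
  let top : Fin n := ⟨n - 1, by omega⟩
  have htop : ∀ k, k ≤ top := fun k => by rw [Fin.le_def]; simp only [top]; omega
  obtain ⟨w, hw⟩ := (cs.mem_faces_iff.1 (F.face_mem top)).2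
  have hex : ∀ k, ∃ i, cs.vertex w i ∈ F.face k ∧ ∀ j < k, cs.vertex w i ∉ F.face j := by
    intro k
    obtain ⟨v, hv, hv'⟩ := F.exists_mem_face_notMem k
    obtain ⟨i, rfl⟩ := cs.mem_chamber.1 (hw (F.face_mono (htop k) hv))
    exact ⟨i, hv, hv'⟩
  choose d hd hd' using hex
  have hinj : Function.Injective d := by
    intro j k hjk
    by_contra hne
    rcases lt_or_gt_of_ne hne with h | h
    · exact hd' k j h (hjk ▸ hd j)
    · exact hd' j k h (hjk ▸ hd k)
  refine ⟨w, Equiv.ofBijective d (Finite.injective_iff_bijective.1 hinj), ?_⟩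
  refine CompleteFlag.ext (funext fun k => (CompleteFlag.face_eq_of_subset ?_).symm)
  intro X hX
  obtain ⟨i, hi, rfl⟩ := cs.mem_mkFlag_face.1 hX
  exact F.face_mono hi (hd i)

/-- The k-th vertex is the only vertex of the k-face outside the (k - 1)-face; for k = 0 the second
hypothesis is empty. -/
theorem vertex_eq_of_face_eq {w w' : W} {δ δ' : Equiv.Perm (Fin n)} {k : Fin n}
    (hk : (cs.mkFlag w δ).face k = (cs.mkFlag w' δ').face k)
    (hk' : ∀ j : Fin n, (j : ℕ) + 1 = k → (cs.mkFlag w δ).face j = (cs.mkFlag w' δ').face j) :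
    cs.vertex w (δ k) = cs.vertex w' (δ' k) := by
  have h1 : cs.vertex w (δ k) ∈ (cs.mkFlag w' δ').face k := by
    rw [← hk, vertex_mem_mkFlag_face]
  obtain ⟨i, hi, he⟩ := cs.mem_mkFlag_face.1 h1
  rcases hi.eq_or_lt with rfl | hlt
  · exact he.symm
  · rw [Fin.lt_def] at hlt
    let p : Fin n := ⟨k - 1, by omega⟩
    have hip : i ≤ p := by rw [Fin.le_def]; simp only [p]; omega
    have h2 : cs.vertex w (δ k) ∈ (cs.mkFlag w δ).face p := by
      rw [hk' p (by simp only [p]; omega), ← he, vertex_mem_mkFlag_face]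
      exact hip
    rw [vertex_mem_mkFlag_face, Fin.le_def] at h2
    simp only [p] at h2
    omega

theorem mkFlag_injective [Finite W] (hn : 0 < n) {w w' : W} {δ δ' : Equiv.Perm (Fin n)}
    (h : cs.mkFlag w δ = cs.mkFlag w' δ') : w = w' ∧ δ = δ' := by
  constructor
  · apply cs.chamber_injective
    have hk : ((⟨n - 1, by omega⟩ : Fin n) : ℕ) + 1 = n := by simp only; omega
    rw [← cs.mkFlag_face_last hk w δ, ← cs.mkFlag_face_last hk w' δ', h]
  · ext1 k
    exact (cs.vertex_eq_iff.1 (cs.vertex_eq_of_face_eq (by rw [h]) fun j _ => by rw [h])).1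

/-- The top face is kept and with it w; the remaining faces fix the ordering up to an exchange of
positions i and i + 1. -/
theorem sigma_mkFlag_of_lt [Finite W] {i i' : Fin n} (hi : (i : ℕ) + 1 = i') (w : W)
    (δ : Equiv.Perm (Fin n)) :
    CompleteFlag.sigma i (cs.mkFlag w δ) = cs.mkFlag w (δ * Equiv.swap i i') := by
  have hn : 0 < n := i.pos
  have hii' : i ≠ i' := fun h => by rw [← h] at hi; omega
  have hfi' : ¬ i' ≤ i := by rw [Fin.le_def]; omega
  refine CompleteFlag.sigma_eq_of_unique ?_ ?_ ?_
  · intro h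
    have h1 : cs.vertex w ((δ * Equiv.swap i i') i) ∈
        (cs.mkFlag w (δ * Equiv.swap i i')).face i := cs.vertex_mem_mkFlag_face.2 le_rfl
    rw [h, Equiv.Perm.mul_apply, Equiv.swap_apply_left, vertex_mem_mkFlag_face] at h1
    exact hfi' h1
  · intro j hj
    refine CompleteFlag.face_eq_of_subset fun X hX => ?_
    obtain ⟨l, hl, rfl⟩ := cs.mem_mkFlag_face.1 hX
    rw [Equiv.Perm.mul_apply, vertex_mem_mkFlag_face]
    rw [Fin.le_def] at hl ⊢
    have hj' : (j : ℕ) ≠ i := fun h => hj (Fin.ext h)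
    rcases eq_or_ne l i with rfl | h1
    · rw [Equiv.swap_apply_left]; omega
    rcases eq_or_ne l i' with rfl | h2
    · rw [Equiv.swap_apply_right]; omega
    · rwa [Equiv.swap_apply_of_ne_of_ne h1 h2]
  · intro G hGi hGj
    obtain ⟨w', δ', rfl⟩ := cs.exists_eq_mkFlag hn G
    have hw : w' = w := by
      have hk : ((⟨n - 1, by omega⟩ : Fin n) : ℕ) + 1 = n := by simp only; omega
      have := hGj ⟨n - 1, by omega⟩ fun h => by
        have := congrArg Fin.val h
        have := i'.2
        simp only at *
        omega
      rw [cs.mkFlag_face_last hk, cs.mkFlag_face_last hk] at this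
      exact cs.chamber_injective this
    subst hw
    have hδ : ∀ l, l ≠ i → l ≠ i' → δ' l = δ l := by
      intro l h1 h2
      refine (cs.vertex_eq_iff.1 (cs.vertex_eq_of_face_eq (hGj l h1) fun j hj => hGj j ?_)).1
      rintro rfl
      exact h2 (Fin.ext (by omega))
    have hcases : ∀ l, l = i ∨ l = i' → δ' l = δ i ∨ δ' l = δ i' := by
      intro l hl
      obtain ⟨a, ha⟩ := δ.surjective (δ' l)
      by_cases h1 : a = i
      · left; rw [← ha, h1]
      by_cases h2 : a = i'
      · right; rw [← ha, h2]
      · rw [← hδ a h1 h2] at ha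
        have := δ'.injective ha
        rcases hl with rfl | rfl
        · exact absurd this h1
        · exact absurd this h2
    have h1 : δ' i = δ i' := by
      refine (hcases i (Or.inl rfl)).resolve_left fun h => hGi ?_
      refine CompleteFlag.face_eq_of_subset fun X hX => ?_
      obtain ⟨l, hl, rfl⟩ := cs.mem_mkFlag_face.1 hX
      have : δ' l = δ l := by
        rcases eq_or_ne l i with rfl | hli
        · exact h
        · exact hδ l hli (by rintro rfl; exact hfi' hl)
      rw [this, vertex_mem_mkFlag_face]
      exact hl
    have h2 : δ' i' = δ i := by
      refine (hcases i' (Or.inr rfl)).resolve_right fun h => hii' ?_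
      exact δ'.injective (h1.trans h.symm)
    congr 1
    ext1 l
    rw [Equiv.Perm.mul_apply]
    rcases eq_or_ne l i with rfl | hl1
    · rw [Equiv.swap_apply_left, h1]
    rcases eq_or_ne l i' with rfl | hl2
    · rw [Equiv.swap_apply_right, h2]
    · rw [Equiv.swap_apply_of_ne_of_ne hl1 hl2, hδ l hl1 hl2]

/-- The vertices of types other than δ(i) are kept, so w changes by an element of all the other
maximal parabolic subgroups, which is 1 or s_{δ(i)}. -/
theorem sigma_mkFlag_last [Finite W] {i : Fin n} (hi : (i : ℕ) + 1 = n) (w : W)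
    (δ : Equiv.Perm (Fin n)) :
    CompleteFlag.sigma i (cs.mkFlag w δ) = cs.mkFlag (w * cs.simple (δ i)) δ := by
  have hn : 0 < n := i.pos
  refine CompleteFlag.sigma_eq_of_unique ?_ ?_ ?_
  · rw [cs.mkFlag_face_last hi, cs.mkFlag_face_last hi]
    intro h
    have h1 := cs.chamber_injective h
    have h2 : cs.simple (δ i) = 1 := by simpa using h1
    exact cs.simple_notMem_maxParabolic (δ i) (h2 ▸ one_mem _)
  · intro j hj
    refine CompleteFlag.face_eq_of_subset fun X hX => ?_
    obtain ⟨l, hl, rfl⟩ := cs.mem_mkFlag_face.1 hX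
    have hli : i ≠ l := by
      rintro rfl
      apply hj
      rw [Fin.le_def] at hl
      exact Fin.ext (by omega)
    rw [cs.vertex_mul_simple (fun h => hli (δ.injective h)), vertex_mem_mkFlag_face]
    exact hl
  · intro G hGi hGj
    obtain ⟨w', δ', rfl⟩ := cs.exists_eq_mkFlag hn G
    have hv : ∀ l, l ≠ i → cs.vertex w (δ l) = cs.vertex w' (δ' l) := by
      intro l hl
      refine cs.vertex_eq_of_face_eq (hGj l hl).symm fun j hj => (hGj j ?_).symm
      rintro rfl
      omega
    have hδ : ∀ l, l ≠ i → δ l = δ' l := fun l hl => (cs.vertex_eq_iff.1 (hv l hl)).1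
    have hδi : δ i = δ' i := by
      obtain ⟨a, ha⟩ := δ.surjective (δ' i)
      by_cases h1 : a = i
      · rw [← ha, h1]
      · rw [hδ a h1] at ha
        exact absurd (δ'.injective ha) h1
    have hδ' : δ' = δ := by
      ext1 l
      by_cases h : l = i
      · rw [h, hδi]
      · rw [hδ l h]
    subst hδ'
    have := cs.eq_one_or_eq_simple_of_forall_mem_maxParabolic (w := w⁻¹ * w') (j := δ' i)
      fun a ha => by
        obtain ⟨l, rfl⟩ := δ'.surjective a
        exact (cs.vertex_eq_iff.1 (hv l fun h => ha (by rw [h]))).2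
    rcases this with h | h
    · rw [inv_mul_eq_one.1 h] at hGi
      exact absurd rfl hGi
    · rw [← h]; simp

theorem reverse_mkFlag (w : W) (δ : Equiv.Perm (Fin n)) :
    (cs.mkFlag w δ).reverse = cs.mkFlag w (δ * Fin.revPerm) := by
  refine CompleteFlag.ext (funext fun k => (CompleteFlag.face_eq_of_subset ?_).symm)
  intro X hX
  obtain ⟨l, hl, rfl⟩ := cs.mem_mkFlag_face.1 hX
  rw [Fin.le_def] at hl
  have hk := k.2
  simp only [CompleteFlag.reverse, Finset.mem_filter, Equiv.Perm.mul_apply,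
    vertex_mem_mkFlag_face, Fin.le_def, Fin.revPerm_apply, Fin.val_rev]
  refine ⟨by omega, fun j hj => by omega⟩

end CoxeterSystem

/-! ### Counting the orbits of a free dihedral action -/

/-- Let `T` and `R` generate a free action of a dihedral group of order `2 N` on `α`. If the
classes of the equivalence relation generated by `r` are the orbits, then each has `2 N` elements
and the number of classes is determined by the cardinality of `α`. -/
theorem Function.card_eq_card_quot_mul_of_dihedral {α : Type*} {T R : α → α} {N : ℕ}
    (hT : ∀ x, Function.minimalPeriod T x = N) (hN : 0 < N) (hR : ∀ x, R (R x) = x)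
    (hTR : ∀ x, T (R (T x)) = R x) (hfree : ∀ x k, R x ≠ T^[k] x) (r : α → α → Prop)
    (hr : ∀ x y, r x y → ∃ k, y = T^[k] x ∨ y = T^[k] (R x))
    (hrT : ∀ x k, r x (T^[k] x)) (hrR : ∀ x, r x (R (T^[N - 1] x))) :
    Nat.card α = Nat.card (Quot r) * (2 * N) := by
  have hper : ∀ x, T^[N] x = x := fun x => by
    have := Function.iterate_minimalPeriod (f := T) (x := x)
    rwa [hT] at this
  have hperm : ∀ k x, T^[N * k] x = x := fun k x => by
    have : Function.IsPeriodicPt T N x := hper x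
    exact (this.mul_const k)
  have hTRk : ∀ k x, T^[k] (R (T^[k] x)) = R x := by
    intro k
    induction k with
    | zero => intro x; rfl
    | succ k ih =>
      intro x
      rw [Function.iterate_succ_apply' T k x, Function.iterate_succ_apply, hTR, ih]
  -- `N * k - k` is a natural number that serves as the exponent -k modulo N.
  have hback : ∀ k x, T^[N * k - k] (T^[k] x) = x := fun k x => by
    rw [← Function.iterate_add_apply, Nat.sub_add_cancel (Nat.le_mul_of_pos_left k hN), hperm]
  have hRT : ∀ k x, R (T^[k] x) = T^[N * k - k] (R x) := fun k x => by
    conv_rhs => rw [← hTRk k x]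
    rw [hback]
  let E : α → α → Prop := fun x y => ∃ k, y = T^[k] x ∨ y = T^[k] (R x)
  have hE : Equivalence E := by
    refine ⟨fun x => ⟨0, Or.inl rfl⟩, ?_, ?_⟩
    · rintro x y ⟨k, rfl | rfl⟩
      · exact ⟨N * k - k, Or.inl (hback k x).symm⟩
      · exact ⟨k, Or.inr (by rw [hTRk, hR])⟩
    · rintro x y z ⟨k, rfl | rfl⟩ ⟨l, rfl | rfl⟩
      · exact ⟨l + k, Or.inl (Function.iterate_add_apply T l k x).symm⟩
      · exact ⟨l + (N * k - k), Or.inr (by rw [hRT, Function.iterate_add_apply])⟩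
      · exact ⟨l + k, Or.inr (Function.iterate_add_apply T l k _).symm⟩
      · exact ⟨l + (N * k - k), Or.inl (by rw [hRT, hR, Function.iterate_add_apply])⟩
  have hEr : ∀ x y, Quot.mk r x = Quot.mk r y ↔ E x y := by
    intro x y
    constructor
    · intro h
      have := Quot.eqvGen_exact h
      exact hE.eqvGen_iff.1 (this.mono hr)
    · rintro ⟨k, rfl | rfl⟩
      · exact Quot.sound (hrT x k)
      -- `r` relates x to R (T^(N - 1) x) = T (R x), from which further powers of T lead to T^k (R
      -- x).
      · have h1 : T^[k + 1] (R (T^[N] x)) = T^[k] (R (T^[N - 1] x)) := by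
          rw [Function.iterate_succ_apply]
          conv_lhs => rw [← Nat.sub_add_cancel hN, Function.iterate_succ_apply', hTR]
        have h2 : R (T^[N - 1] x) = T (R x) := by
          rw [← hTR, ← Function.iterate_succ_apply' T, Nat.succ_eq_add_one,
            Nat.sub_add_cancel hN, hper]
        have h3 : T^[k] (R x) = T^[k + (N - 1)] (R (T^[N - 1] x)) := by
          rw [h2, ← Function.iterate_succ_apply, Nat.succ_eq_add_one, add_assoc,
            Nat.sub_add_cancel hN, Function.iterate_add_apply, hper]
        rw [h3]
        exact (Quot.sound (hrR x)).trans (Quot.sound (hrT _ _))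
  -- The class of x consists of T^a x and T^a (R x) with a < N, and freeness makes these 2 N
  -- elements distinct.
  have hfiber : ∀ q : Quot r, Nonempty ({x : α // Quot.mk r x = q} ≃ Bool × Fin N) := by
    intro q
    obtain ⟨x, rfl⟩ := Quot.exists_rep q
    let f : Bool × Fin N → {y : α // Quot.mk r y = Quot.mk r x} := fun p =>
      ⟨T^[p.2] (if p.1 then R x else x), by
        rw [eq_comm, hEr]
        refine ⟨p.2, ?_⟩
        rcases p with ⟨b, a⟩
        cases b <;> simp⟩
    have hinj : ∀ x (a b : Fin N), T^[a] x = T^[b] x → a = b := fun x a b h => by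
      have := Function.iterate_injOn_Iio_minimalPeriod (f := T) (x := x)
      rw [hT] at this
      exact Fin.ext (this a.2 b.2 h)
    have hne : ∀ (a b : ℕ), T^[a] x ≠ T^[b] (R x) := fun a b h => by
      apply hfree x (N * b - b + a)
      rw [Function.iterate_add_apply, h, hback]
    refine ⟨(Equiv.ofBijective f ⟨?_, ?_⟩).symm⟩
    · rintro ⟨b, a⟩ ⟨b', a'⟩ h
      have h' := congrArg Subtype.val h
      cases b <;> cases b' <;> simp only [f, if_true, Bool.false_eq_true, if_false] at h'
      · rw [hinj _ _ _ h']
      · exact absurd h' (hne _ _)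
      · exact absurd h'.symm (hne _ _)
      · rw [hinj _ _ _ h']
    · rintro ⟨y, hy⟩
      obtain ⟨k, hk⟩ := (hEr x y).1 hy.symm
      have hmod : ∀ z, T^[k % N] z = T^[k] z := fun z => by
        have := Function.iterate_mod_minimalPeriod_eq (f := T) (x := z) (n := k)
        rwa [hT] at this
      rcases hk with rfl | rfl
      · exact ⟨(false, ⟨k % N, Nat.mod_lt _ hN⟩), Subtype.ext (by simp [f, hmod])⟩
      · exact ⟨(true, ⟨k % N, Nat.mod_lt _ hN⟩), Subtype.ext (by simp [f, hmod])⟩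
  have e : α ≃ Quot r × (Bool × Fin N) :=
    (Equiv.sigmaFiberEquiv (Quot.mk r)).symm.trans
      ((Equiv.sigmaCongrRight fun q => (hfiber q).some).trans (Equiv.sigmaEquivProd _ _))
  rw [Nat.card_congr e, Nat.card_prod, Nat.card_prod]
  simp

/-! ### Zigzags of the Coxeter complex -/

namespace AbstractSimplicialComplex

variable {V : Type*} {K : AbstractSimplicialComplex V} {n : ℕ}

/-- A zigzag is determined by its first flag. -/
noncomputable def zigzagEquiv : Zigzag K n ≃ CompleteFlag K n where
  toFun Z := Z.flag 0
  invFun F := ⟨fun i => CompleteFlag.T^[i] F, fun _ => rfl⟩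
  left_inv Z := Zigzag.ext (funext fun i => (Z.flag_eq i).symm)
  right_inv _ := rfl

end AbstractSimplicialComplex

namespace CoxeterSystem

open AbstractSimplicialComplex

variable {m : ℕ} {M : CoxeterMatrix (Fin (m + 1))} {W : Type*} [Group W] (cs : CoxeterSystem M W)

/-- The exchanges carry the entry δ(0) to position k and move the entries that it passes one place
to the left. -/
theorem foldl_sigma_mkFlag [Finite W] (w : W) (δ : Equiv.Perm (Fin (m + 1))) (k : ℕ)
    (hk : k < m + 1) :
    ((List.finRange (m + 1)).take k).foldl (fun G i => CompleteFlag.sigma i G) (cs.mkFlag w δ)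
      = cs.mkFlag w (δ * Fin.cycleRange ⟨k, hk⟩) := by
  induction k with
  | zero => simp
  | succ k ih =>
    have hk' : k < m + 1 := by omega
    rw [List.take_succ_eq_append_getElem (by simpa using hk'), List.foldl_append, ih hk',
      List.getElem_finRange, List.foldl_cons, List.foldl_nil,
      cs.sigma_mkFlag_of_lt (i' := ⟨k + 1, hk⟩) (by simp), mul_assoc]
    congr 2
    ext1 l
    simp only [Equiv.Perm.mul_apply, Fin.cast_mk]
    have hne : (⟨k, hk'⟩ : Fin (m + 1)) ≠ ⟨k + 1, hk⟩ := by simp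
    rcases lt_trichotomy (l : ℕ) k with h | h | h
    · rw [Equiv.swap_apply_of_ne_of_ne (Fin.ne_of_val_ne (by simp; omega))
        (Fin.ne_of_val_ne (by simp; omega)), Fin.cycleRange_of_lt (by rw [Fin.lt_def]; exact h),
        Fin.cycleRange_of_lt (by rw [Fin.lt_def]; simp; omega)]
    · obtain rfl : l = ⟨k, hk'⟩ := Fin.ext h
      rw [Equiv.swap_apply_left, Fin.cycleRange_of_gt (by simp [Fin.lt_def]),
        Fin.cycleRange_of_lt (by simp [Fin.lt_def])]
      ext
      simp [Fin.val_add, Nat.mod_eq_of_lt hk]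
    · by_cases h' : (l : ℕ) = k + 1
      · obtain rfl : l = ⟨k + 1, hk⟩ := Fin.ext h'
        rw [Equiv.swap_apply_right, Fin.cycleRange_self, Fin.cycleRange_self]
      · rw [Equiv.swap_apply_of_ne_of_ne (Fin.ne_of_val_ne (by simp; omega))
          (Fin.ne_of_val_ne (by simp; omega)), Fin.cycleRange_of_gt (by rw [Fin.lt_def]; exact h),
          Fin.cycleRange_of_gt (by rw [Fin.lt_def]; simp; omega)]

/-- The entry δ(0) has reached the last position when the last `sigma` acts, whence the factor
s_{δ(0)}. -/
theorem T_mkFlag [Finite W] (w : W) (δ : Equiv.Perm (Fin (m + 1))) :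
    (cs.mkFlag w δ).T = cs.mkFlag (w * cs.simple (δ 0)) (δ * finRotate (m + 1)) := by
  have h : List.finRange (m + 1) = (List.finRange (m + 1)).take (m + 1) := by simp
  rw [CompleteFlag.T, h, List.take_succ_eq_append_getElem (by simp), List.foldl_append,
    cs.foldl_sigma_mkFlag w δ m (by omega), List.getElem_finRange, List.foldl_cons,
    List.foldl_nil, cs.sigma_mkFlag_last (by simp)]
  have hlast : (⟨m, by omega⟩ : Fin (m + 1)) = Fin.last m := rfl
  simp [hlast]

/-- The product `s_{δ(1)} ⋯ s_{δ(i)}`, where the indices are taken modulo the rank. -/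
def periodicPrefix (δ : Equiv.Perm (Fin (m + 1))) (i : ℕ) : W :=
  cs.wordProd ((List.range i).map fun l => δ (Fin.ofNat (m + 1) l))

theorem periodicPrefix_succ (δ : Equiv.Perm (Fin (m + 1))) (i : ℕ) :
    cs.periodicPrefix δ (i + 1)
      = cs.periodicPrefix δ i * cs.simple (δ (Fin.ofNat (m + 1) i)) := by
  simp [periodicPrefix, List.range_succ, wordProd_append]

theorem finRotate_pow_apply_zero (i : ℕ) : (finRotate (m + 1) ^ i) 0 = Fin.ofNat (m + 1) i := by
  induction i with
  | zero => rfl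
  | succ i ih =>
    rw [pow_succ', Equiv.Perm.mul_apply, ih, finRotate_apply]
    ext
    simp [Fin.val_add]

theorem finRotate_pow_card : finRotate (m + 1) ^ (m + 1) = 1 := by
  ext1 j
  have h : j = (finRotate (m + 1) ^ (j : ℕ)) 0 := by
    rw [finRotate_pow_apply_zero]
    ext
    simp
  have h0 : (finRotate (m + 1) ^ (m + 1)) 0 = 0 := by
    rw [finRotate_pow_apply_zero]; ext; simp
  rw [h, ← Equiv.Perm.mul_apply, ← (Commute.pow_pow_self _ _ _).eq, Equiv.Perm.mul_apply, h0]
  rfl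

theorem finRotate_pow_eq_one_iff {i : ℕ} : finRotate (m + 1) ^ i = 1 ↔ m + 1 ∣ i := by
  constructor
  · intro h
    have := finRotate_pow_apply_zero (m := m) i
    rw [h] at this
    exact Nat.dvd_of_mod_eq_zero (congrArg Fin.val this).symm
  · rintro ⟨k, rfl⟩
    rw [pow_mul, finRotate_pow_card, one_pow]

theorem iterate_T_mkFlag [Finite W] (w : W) (δ : Equiv.Perm (Fin (m + 1))) (i : ℕ) :
    CompleteFlag.T^[i] (cs.mkFlag w δ)
      = cs.mkFlag (w * cs.periodicPrefix δ i) (δ * finRotate (m + 1) ^ i) := by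
  induction i with
  | zero => simp [periodicPrefix]
  | succ i ih =>
    rw [Function.iterate_succ_apply', ih, T_mkFlag, periodicPrefix_succ, Equiv.Perm.mul_apply,
      finRotate_pow_apply_zero, pow_succ, mul_assoc, mul_assoc]

theorem periodicPrefix_eq_coxeterPrefix (δ : Equiv.Perm (Fin (m + 1))) {j : ℕ} (hj : j ≤ m + 1) :
    cs.periodicPrefix δ j = cs.coxeterPrefix δ j := by
  rw [periodicPrefix, wordProd, coxeterPrefix]
  congr 1
  apply List.ext_getElem
  · simp [hj]
  · intro i h1 h2
    simp only [List.length_map, List.length_range] at h1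
    simp only [List.getElem_map, List.getElem_range, List.getElem_take, List.getElem_ofFn]
    congr 2
    ext
    simp [Nat.mod_eq_of_lt (show i < m + 1 by omega)]

theorem coxeterPrefix_card (δ : Equiv.Perm (Fin (m + 1))) :
    cs.coxeterPrefix δ (m + 1) = cs.coxeterElement δ := by
  rw [coxeterPrefix, coxeterElement, List.take_of_length_le (by simp)]

theorem periodicPrefix_card_add (δ : Equiv.Perm (Fin (m + 1))) (i : ℕ) :
    cs.periodicPrefix δ (m + 1 + i) = cs.coxeterElement δ * cs.periodicPrefix δ i := by
  induction i with
  | zero =>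
    rw [add_zero, periodicPrefix_eq_coxeterPrefix _ _ le_rfl, coxeterPrefix_card]
    simp [periodicPrefix]
  | succ i ih =>
    rw [← add_assoc, periodicPrefix_succ, ih, periodicPrefix_succ, mul_assoc]
    congr 4
    ext
    simp

theorem periodicPrefix_mul_add (δ : Equiv.Perm (Fin (m + 1))) (k i : ℕ) :
    cs.periodicPrefix δ (k * (m + 1) + i) = cs.coxeterElement δ ^ k * cs.periodicPrefix δ i := by
  induction k with
  | zero => simp
  | succ k ih =>
    rw [show (k + 1) * (m + 1) + i = m + 1 + (k * (m + 1) + i) by ring, periodicPrefix_card_add,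
      ih, pow_succ', mul_assoc]

theorem coxeterPrefix_mem_maxParabolic (δ : Equiv.Perm (Fin (m + 1))) (j : Fin (m + 1)) :
    cs.coxeterPrefix δ j ∈ cs.maxParabolic (δ j) := by
  rw [← periodicPrefix_eq_coxeterPrefix _ _ j.2.le, periodicPrefix]
  refine cs.wordProd_mem_closure fun i hi => ?_
  obtain ⟨l, hl, rfl⟩ := List.mem_map.1 hi
  rw [List.mem_range] at hl
  intro h
  have := congrArg Fin.val (δ.injective h)
  simp [Nat.mod_eq_of_lt (hl.trans j.2)] at this
  omega

/-- The shadows of a zigzag in the Coxeter complex. -/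
theorem shadow_eq [Finite W] {Z : cs.coxeterComplex.Zigzag (m + 1)} {w : W}
    {δ : Equiv.Perm (Fin (m + 1))} (hZ : Z.flag 0 = cs.mkFlag w δ) (k : ℕ) (j : Fin (m + 1)) :
    Z.shadow ⟨0, by omega⟩ (k * (m + 1) + j)
        = {cs.vertex (w * cs.coxeterElement δ ^ k) (δ j)} ∧
      Z.shadow ⟨m + 1 - 1, by omega⟩ (k * (m + 1) + j) =
        cs.chamber (w * cs.coxeterElement δ ^ k * cs.coxeterPrefix δ j) := by
  have hP : w * cs.periodicPrefix δ (k * (m + 1) + j)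
      = w * cs.coxeterElement δ ^ k * cs.coxeterPrefix δ j := by
    rw [periodicPrefix_mul_add, periodicPrefix_eq_coxeterPrefix _ _ j.2.le, mul_assoc]
  rw [Zigzag.shadow, Zigzag.shadow, Z.flag_eq, hZ, iterate_T_mkFlag, hP]
  constructor
  · rw [mkFlag_face_zero _ rfl]
    have hidx : (δ * finRotate (m + 1) ^ (k * (m + 1) + j)) ⟨0, by omega⟩ = δ j := by
      change δ ((finRotate (m + 1) ^ (k * (m + 1) + (j : ℕ))) 0) = _
      rw [finRotate_pow_apply_zero]
      congr 1
      ext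
      simp [Nat.mod_eq_of_lt j.2]
    rw [hidx]
    -- The chamber at this time is w s_δ^k times a prefix of length j. That prefix avoids s_{δ(j)},
    -- so it does not change the vertex of type δ(j).
    congr 1
    rw [eq_comm, vertex_eq_iff]
    refine ⟨rfl, ?_⟩
    rw [inv_mul_cancel_left]
    exact cs.coxeterPrefix_mem_maxParabolic δ j
  · exact cs.mkFlag_face_last (by simp) _ _

theorem iterate_T_mkFlag_eq_self_iff [Finite W] (w : W) (δ : Equiv.Perm (Fin (m + 1))) (i : ℕ) :
    CompleteFlag.T^[i] (cs.mkFlag w δ) = cs.mkFlag w δ ↔ (m + 1) * cs.coxeterNumber ∣ i := by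
  have key : ∀ k, cs.periodicPrefix δ ((m + 1) * k) = cs.coxeterElement δ ^ k := fun k => by
    have := cs.periodicPrefix_mul_add δ k 0
    rwa [add_zero, mul_comm, show cs.periodicPrefix δ 0 = 1 by simp [periodicPrefix],
      mul_one] at this
  rw [iterate_T_mkFlag, ← cs.orderOf_coxeterElement δ]
  constructor
  · intro h
    obtain ⟨h1, h2⟩ := cs.mkFlag_injective (by omega) h
    rw [mul_eq_left] at h1 h2
    obtain ⟨k, rfl⟩ := finRotate_pow_eq_one_iff.1 h2
    rw [key] at h1
    exact mul_dvd_mul_left _ (orderOf_dvd_of_pow_eq_one h1)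
  · rintro ⟨k, rfl⟩
    rw [mul_assoc, key, pow_mul (cs.coxeterElement δ), pow_orderOf_eq_one, one_pow, mul_one,
      finRotate_pow_eq_one_iff.2 (dvd_mul_right _ _), mul_one]

theorem minimalPeriod_T [Finite W] (F : CompleteFlag cs.coxeterComplex (m + 1)) :
    Function.minimalPeriod CompleteFlag.T F = (m + 1) * cs.coxeterNumber := by
  obtain ⟨w, δ, rfl⟩ := cs.exists_eq_mkFlag (by omega) F
  apply Nat.dvd_antisymm
  · exact Function.IsPeriodicPt.minimalPeriod_dvd
      ((cs.iterate_T_mkFlag_eq_self_iff w δ _).2 dvd_rfl)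
  · exact (cs.iterate_T_mkFlag_eq_self_iff w δ _).1 Function.iterate_minimalPeriod

theorem coxeterNumber_pos [Finite W] : 0 < cs.coxeterNumber := orderOf_pos _

/-- If times a and b show the same vertex, their residues modulo n agree and s_δ^d lies in a maximal
parabolic subgroup, d being the difference of the quotients. Then h divides d, and d < h. -/
theorem coxeterComplex_isZSimple [Finite W]
    (h : ∀ i, cs.componentCoxeterNumber i = cs.coxeterNumber) :
    cs.coxeterComplex.IsZSimple (m + 1) := by
  intro Z hn a ha b hb hab
  obtain ⟨w, δ, hZ⟩ := cs.exists_eq_mkFlag (by omega) (Z.flag 0)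
  rw [Set.mem_Iio, Zigzag.length, minimalPeriod_T] at ha hb
  have hdecomp : ∀ c : ℕ, c = c / (m + 1) * (m + 1) +
      ((⟨c % (m + 1), Nat.mod_lt _ (by omega)⟩ : Fin (m + 1)) : ℕ) := fun c => by
    rw [mul_comm]
    exact (Nat.div_add_mod c (m + 1)).symm
  have ea := (cs.shadow_eq hZ (a / (m + 1)) ⟨a % (m + 1), Nat.mod_lt _ (by omega)⟩).1
  have eb := (cs.shadow_eq hZ (b / (m + 1)) ⟨b % (m + 1), Nat.mod_lt _ (by omega)⟩).1
  rw [← hdecomp] at ea eb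
  rw [ea, eb, Finset.singleton_inj, vertex_eq_iff] at hab
  have hmod : a % (m + 1) = b % (m + 1) := congrArg Fin.val (δ.injective hab.1)
  have hlt : ∀ c, c < (m + 1) * cs.coxeterNumber → c / (m + 1) < cs.coxeterNumber := fun c hc =>
    Nat.div_lt_of_lt_mul hc
  have key : ∀ k l : ℕ, k ≤ l → l < cs.coxeterNumber → ∀ i,
      (cs.coxeterElement δ ^ k)⁻¹ * cs.coxeterElement δ ^ l ∈ cs.maxParabolic i → k = l := by
    intro k l hkl hl i hmem
    obtain ⟨d, rfl⟩ := Nat.exists_eq_add_of_le hkl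
    rw [pow_add, inv_mul_cancel_left] at hmem
    have hdvd := cs.componentCoxeterNumber_dvd δ d i hmem
    rw [h] at hdvd
    have := Nat.eq_zero_of_dvd_of_lt hdvd (by omega)
    omega
  have hmem : (cs.coxeterElement δ ^ (a / (m + 1)))⁻¹ * cs.coxeterElement δ ^ (b / (m + 1)) ∈
      cs.maxParabolic (δ ⟨a % (m + 1), Nat.mod_lt _ (by omega)⟩) := by
    have := hab.2
    rwa [mul_inv_rev, mul_assoc, inv_mul_cancel_left] at this
  have hdiv : a / (m + 1) = b / (m + 1) := by
    rcases le_total (a / (m + 1)) (b / (m + 1)) with hle | hle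
    · exact key _ _ hle (hlt b hb) _ hmem
    · have := inv_mem hmem
      rw [mul_inv_rev, inv_inv] at this
      exact (key _ _ hle (hlt a ha) _ this).symm
  rw [← Nat.div_add_mod a (m + 1), ← Nat.div_add_mod b (m + 1), hmod, hdiv]

theorem reverse_reverse (F : CompleteFlag cs.coxeterComplex (m + 1)) :
    F.reverse.reverse = F := by
  obtain ⟨w, δ, rfl⟩ := cs.exists_eq_mkFlag (by omega) F
  rw [reverse_mkFlag, reverse_mkFlag, mul_assoc]
  congr 1
  ext1 i
  simp

/-- T sends the entry δ(0) to the end and reversal returns it to the front, so both applications of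
T multiply w by the same involution. -/
theorem T_reverse_T [Finite W] (F : CompleteFlag cs.coxeterComplex (m + 1)) :
    F.T.reverse.T = F.reverse := by
  obtain ⟨w, δ, rfl⟩ := cs.exists_eq_mkFlag (by omega) F
  rw [T_mkFlag, reverse_mkFlag, T_mkFlag, reverse_mkFlag]
  have h0 : (δ * finRotate (m + 1) * Fin.revPerm : Equiv.Perm (Fin (m + 1))) 0 = δ 0 := by simp
  rw [h0]
  congr 1
  · simp
  · rw [mul_assoc, mul_assoc]
    congr 1
    ext1 i
    simp only [Equiv.Perm.mul_apply, finRotate_apply, Fin.revPerm_apply]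
    by_cases hi : i = Fin.last m
    · subst hi
      ext
      simp
    · have h1 : ((i + 1 : Fin (m + 1)) : ℕ) = i + 1 := Fin.val_add_one_of_lt
        (Fin.lt_last_iff_ne_last.2 hi)
      have hi' : (i : ℕ) < m := by
        have := Fin.lt_last_iff_ne_last.2 hi
        rwa [Fin.lt_def] at this
      have h2 : ((i + 1).rev : ℕ) = m - (i + 1) := by rw [Fin.val_rev, h1]; omega
      have h3 : (i + 1).rev ≠ Fin.last m := fun h => by
        have := congrArg Fin.val h
        rw [h2, Fin.val_last] at this
        omega
      ext
      rw [Fin.val_add_one_of_lt (Fin.lt_last_iff_ne_last.2 h3), h2, Fin.val_rev]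
      omega

theorem lengthParity_periodicPrefix (δ : Equiv.Perm (Fin (m + 1))) (i : ℕ) :
    cs.lengthParity (cs.periodicPrefix δ i) = Multiplicative.ofAdd (i : ZMod 2) := by
  induction i with
  | zero => simp [periodicPrefix]
  | succ i ih =>
    rw [periodicPrefix_succ, map_mul, ih, lengthParity_simple, ← ofAdd_add]
    push_cast
    rfl

/-- Evaluation at 0 and 1 shows that reversal is a rotation only for n = 2 (given n ≥ 2). There k is
odd, and T^k multiplies w by an element of odd length, which is not 1. -/
theorem reverse_ne_iterate_T [Finite W] (hm : 1 ≤ m)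
    (F : CompleteFlag cs.coxeterComplex (m + 1)) (k : ℕ) : F.reverse ≠ CompleteFlag.T^[k] F := by
  obtain ⟨w, δ, rfl⟩ := cs.exists_eq_mkFlag (by omega) F
  rw [reverse_mkFlag, iterate_T_mkFlag]
  intro h
  obtain ⟨h1, h2⟩ := cs.mkFlag_injective (by omega) h
  have hrev : Fin.revPerm = finRotate (m + 1) ^ k := mul_left_cancel h2
  have hP : cs.periodicPrefix δ k = 1 := by simpa using h1.symm
  have hk0 : m = k % (m + 1) := by
    have := congrArg Fin.val (congrArg (fun σ => σ 0) hrev)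
    simpa [finRotate_pow_apply_zero] using this
  have hk1 : m - 1 = (k + 1) % (m + 1) := by
    have h3 := congrArg (fun σ => σ ((finRotate (m + 1) ^ 1) 0)) hrev
    simp only [← Equiv.Perm.mul_apply, ← pow_add] at h3
    rw [Equiv.Perm.mul_apply, finRotate_pow_apply_zero, finRotate_pow_apply_zero] at h3
    have := congrArg Fin.val h3
    simpa [Fin.val_rev, Nat.mod_eq_of_lt (show 1 < m + 1 by omega)] using this
  have hm1 : m = 1 := by
    rw [Nat.add_mod, ← hk0, Nat.mod_eq_of_lt (show 1 < m + 1 by omega), Nat.mod_self] at hk1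
    omega
  subst hm1
  have hpar := cs.lengthParity_periodicPrefix δ k
  rw [hP, map_one, eq_comm, ofAdd_eq_one, ZMod.natCast_eq_zero_iff] at hpar
  omega

theorem card_completeFlag [Finite W] :
    Nat.card (CompleteFlag cs.coxeterComplex (m + 1)) = Nat.card W * (m + 1).factorial := by
  have hbij : Function.Bijective
      (fun p : W × Equiv.Perm (Fin (m + 1)) => cs.mkFlag p.1 p.2) := by
    constructor
    · rintro ⟨w, δ⟩ ⟨w', δ'⟩ h
      obtain ⟨rfl, rfl⟩ := cs.mkFlag_injective (by omega) h
      rfl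
    · intro F
      obtain ⟨w, δ, rfl⟩ := cs.exists_eq_mkFlag (by omega) F
      exact ⟨(w, δ), rfl⟩
  rw [← Nat.card_congr (Equiv.ofBijective _ hbij), Nat.card_prod, Nat.card_perm, Nat.card_fin]

theorem card_completeFlag_eq_card_zigzagClass_mul [Finite W] (hm : 1 ≤ m) :
    Nat.card (CompleteFlag cs.coxeterComplex (m + 1))
      = Nat.card (cs.coxeterComplex.ZigzagClass (m + 1)) * (2 * ((m + 1) * cs.coxeterNumber)) := by
  set N := (m + 1) * cs.coxeterNumber with hN
  have hNpos : 0 < N := Nat.mul_pos (by omega) cs.coxeterNumber_pos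
  let r : CompleteFlag cs.coxeterComplex (m + 1) → CompleteFlag cs.coxeterComplex (m + 1) → Prop :=
    fun F G => (zigzagEquiv.symm F).IsShift (zigzagEquiv.symm G) ∨
      (zigzagEquiv.symm F).IsReverse (zigzagEquiv.symm G)
  have hflag : ∀ (F : CompleteFlag cs.coxeterComplex (m + 1)) i,
    (zigzagEquiv.symm F).flag i = CompleteFlag.T^[i] F := fun F i => rfl
  have hlen : ∀ F : CompleteFlag cs.coxeterComplex (m + 1), (zigzagEquiv.symm F).length = N :=
    fun F => cs.minimalPeriod_T _
  have hcongr : Nat.card (cs.coxeterComplex.ZigzagClass (m + 1)) = Nat.card (Quot r) :=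
    Nat.card_congr (Quot.congr zigzagEquiv fun Z Z' => by simp [r])
  have hTRk : ∀ k (F : CompleteFlag cs.coxeterComplex (m + 1)),
      CompleteFlag.T^[k] (CompleteFlag.T^[k] F).reverse = F.reverse := by
    intro k
    induction k with
    | zero => intro F; rfl
    | succ k ih =>
      intro F
      rw [Function.iterate_succ_apply' _ k F, Function.iterate_succ_apply, T_reverse_T, ih]
  rw [hcongr]
  refine Function.card_eq_card_quot_mul_of_dihedral (T := CompleteFlag.T)
    (R := CompleteFlag.reverse) cs.minimalPeriod_T hNpos cs.reverse_reverse cs.T_reverse_T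
    (cs.reverse_ne_iterate_T hm) r ?_ ?_ ?_
  · rintro F G (⟨k, hk⟩ | h)
    · have := hk 0
      rw [hflag, hflag, zero_add] at this
      exact ⟨k, Or.inl this⟩
    · have := h 0
      rw [hflag, hflag, hlen, Nat.zero_mod, Nat.sub_zero] at this
      -- The reverse zigzag starts at R (T^(N - 1) F) = T (R F).
      refine ⟨1, Or.inr ?_⟩
      have hper : CompleteFlag.T^[N] F = F := by
        have := Function.iterate_minimalPeriod (f := CompleteFlag.T) (x := F)
        rwa [cs.minimalPeriod_T] at this
      have hF : CompleteFlag.T (CompleteFlag.T^[N - 1] F) = F := by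
        rw [← Function.iterate_succ_apply' CompleteFlag.T, Nat.succ_eq_add_one,
          Nat.sub_add_cancel hNpos, hper]
      have hTR := cs.T_reverse_T (CompleteFlag.T^[N - 1] F)
      rw [hF] at hTR
      exact this.trans hTR.symm
  · intro F k
    refine Or.inl ⟨k, fun i => ?_⟩
    rw [hflag, hflag, Function.iterate_add_apply]
  · intro F
    refine Or.inr fun i => ?_
    rw [hlen, hflag, hflag]
    have hmod : ∀ z : CompleteFlag cs.coxeterComplex (m + 1),
        CompleteFlag.T^[i % N] z = CompleteFlag.T^[i] z := fun z => by
      have := Function.iterate_mod_minimalPeriod_eq (f := CompleteFlag.T) (x := z) (n := i)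
      rwa [cs.minimalPeriod_T] at this
    have hlt := Nat.mod_lt i hNpos
    rw [← hmod]
    -- T^k R T^k = R with k = i % N shows that the reversed flags, in reversed order, form a zigzag.
    conv_lhs => rw [show N - 1 = i % N + (N - 1 - i % N) by omega, Function.iterate_add_apply]
    rw [hTRk]

theorem card_zigzagClass [Finite W] (hm : 1 ≤ m) :
    (Nat.card (cs.coxeterComplex.ZigzagClass (m + 1)) : ℚ)
      = Nat.card W * m.factorial / (2 * cs.coxeterNumber) := by
  have h := cs.card_completeFlag_eq_card_zigzagClass_mul hm
  rw [card_completeFlag, Nat.factorial_succ] at h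
  have hq : (Nat.card W : ℚ) * ((m + 1) * m.factorial)
      = Nat.card (cs.coxeterComplex.ZigzagClass (m + 1)) * (2 * ((m + 1) * cs.coxeterNumber)) := by
    exact_mod_cast h
  have h0 : (cs.coxeterNumber : ℚ) ≠ 0 := by exact_mod_cast cs.coxeterNumber_pos.ne'
  have hm0 : (m : ℚ) + 1 ≠ 0 := by positivity
  rw [eq_div_iff (by positivity)]
  apply mul_left_cancel₀ hm0
  linarith

end CoxeterSystem

theorem proposition3p5 {n : ℕ} (hn : 1 ≤ n) {M : CoxeterMatrix (Fin n)}
    {W : Type*} [Group W] [Finite W] (cs : CoxeterSystem M W) :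
    -- the Coxeter complex is a thin complex of rank `n`, and all Coxeter elements have order `h`
    (cs.coxeterComplex.IsPure n ∧ cs.coxeterComplex.IsThin n) ∧
    (∀ δ : Equiv.Perm (Fin n), orderOf (cs.coxeterElement δ) = cs.coxeterNumber) ∧
    -- all zigzags are simple, if all irreducible components have the same Coxeter number
    ((∀ i, cs.componentCoxeterNumber i = cs.coxeterNumber) → cs.coxeterComplex.IsZSimple n) ∧
    -- number and length of the zigzags
    (2 ≤ n → (Nat.card (cs.coxeterComplex.ZigzagClass n) : ℚ) =
      (Nat.card W : ℚ) * ((n - 1).factorial : ℚ) / (2 * (cs.coxeterNumber : ℚ))) ∧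
    (∀ Z : cs.coxeterComplex.Zigzag n, Z.length = n * cs.coxeterNumber) ∧
    -- shadows: every zigzag has the given form, and all these forms occur
    (∀ Z : cs.coxeterComplex.Zigzag n, ∃ (w : W) (δ : Equiv.Perm (Fin n)),
      ∀ (k : ℕ) (j : Fin n),
        Z.shadow ⟨0, by omega⟩ (k * n + j) = {cs.vertex (w * cs.coxeterElement δ ^ k) (δ j)} ∧
        Z.shadow ⟨n - 1, by omega⟩ (k * n + j) =
          cs.chamber (w * cs.coxeterElement δ ^ k * cs.coxeterPrefix δ j)) ∧
    (∀ (w : W) (δ : Equiv.Perm (Fin n)), ∃ Z : cs.coxeterComplex.Zigzag n,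
      ∀ (k : ℕ) (j : Fin n),
        Z.shadow ⟨0, by omega⟩ (k * n + j) = {cs.vertex (w * cs.coxeterElement δ ^ k) (δ j)} ∧
        Z.shadow ⟨n - 1, by omega⟩ (k * n + j) =
          cs.chamber (w * cs.coxeterElement δ ^ k * cs.coxeterPrefix δ j)) := by
  obtain ⟨m, rfl⟩ : ∃ m, n = m + 1 := ⟨n - 1, by omega⟩
  refine ⟨⟨cs.coxeterComplex_isPure hn, cs.coxeterComplex_isThin hn⟩, cs.orderOf_coxeterElement,
    cs.coxeterComplex_isZSimple, fun hm => ?_, fun Z => cs.minimalPeriod_T _, fun Z => ?_,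
    fun w δ => ⟨AbstractSimplicialComplex.zigzagEquiv.symm (cs.mkFlag w δ), cs.shadow_eq rfl⟩⟩
  · exact cs.card_zigzagClass (by omega)
  · obtain ⟨w, δ, hZ⟩ := cs.exists_eq_mkFlag hn (Z.flag 0)
    exact ⟨w, δ, cs.shadow_eq hZ⟩
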